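/- Setting. Let $\mu_1,\mu_2,\delta_1,\delta_2\in\mathbb R^n$, let $\Sigma_1,\Sigma_2$ be positive definite $n\times n$ matrices, let $\alpha,\beta:\mathbb R^q\to[0,\infty)$ be measurable, let $H$ be a probability distribution on $\mathbb R^q$, and let $g:[0,\infty)\to[0,\infty)$ be measurable with $0<\int_0^\infty z^{n/2-1}g(z)\,dz<\infty$. For $i=1,2$ let $Y_i$ be an $n$-dimensional random vector with the location-scale mixture of elliptical distribution $LSE_n(\mu_i,\Sigma_i,\delta_i,g,\alpha,\beta,H)$, that is, $$Y_i\overset{d}{=}\mu_i+\alpha(Z)X_i+\beta(Z)\delta_i,$$ where $Z\sim H$ is independent of $X_i$, and $X_i$ is elliptically distributed with location $0$, scale matrix $\Sigma_i$ and density generator $g$, i.e. it has the density $x\mapsto c_n|\Sigma_i|^{-1/2}g(x^T\Sigma_i^{-1}x)$ with $c_n=\frac{\Gamma(n/2)}{\pi^{n/2}}\big(\int_0^\infty z^{n/2-1}g(z)\,dz\big)^{-1}$ (so its characteristic function is $t\mapsto\psi(t^T\Sigma_i t)$ for some $\psi$ with $\psi(0)=1$). A function $f:\mathbb R^n\to\mathbb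 R$ is directionally convex if $\Delta_i^{\varepsilon_1}\Delta_j^{\varepsilon_2}f(x)\ge0$ for all $x\in\mathbb R^n$, $\varepsilon_1,\varepsilon_2\ge0$ and $1\le i,j\le n$, where $\Delta_i^{\varepsilon}f(x)=f(x+\varepsilon e_i)-f(x)$. One writes $Y_1\le_{dcx}Y_2$ if $Ef(Y_1)\le Ef(Y_2)$ for all measurable directionally convex $f$ for which both expectations are well defined in $[-\infty,\infty]$. $\Sigma_2\ge\Sigma_1$ means $(\Sigma_2)_{ij}\ge(\Sigma_1)_{ij}$ for all $i,j$. Theorem. 1. If $\mu_1=\mu_2$, $\delta_1=\delta_2$ and $\Sigma_2\ge\Sigma_1$, then $Y_1\le_{dcx}Y_2$. Assume for 2 and 3 that $Y_1$ and $Y_2$ have finite second moments (so that their means and covariance matrices exist) and that $\alpha(Z)$ is not almost surely $0$. 2. Assume moreover that $\beta(Z)$ is not almost surely $0$. If $\mu_1=\mu_2$, then $Y_1\le_{dcx}Y_2$ if and only if $\delta_1=\delta_2$ and $\Sigma_2\ge\Sigma_1$. 3. If $\delta_1=\delta_2$, then $Y_1\le_{dcx}Y_2$ if and only if $\mu_1=\mu_2$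 and $\Sigma_2\ge\Sigma_1$. -/

import Mathlib

open MeasureTheory ProbabilityTheory
open scoped Matrix ENNReal

/-- The quadratic form `xᵀ S x`. -/
def quadForm {n : ℕ} (S : Matrix (Fin n) (Fin n) ℝ) (x : EuclideanSpace ℝ (Fin n)) : ℝ :=
  x.ofLp ⬝ᵥ (S *ᵥ x.ofLp)

/-- The law `Q` on `ℝⁿ` is elliptical with location `μ`, scale matrix `S` and characteristic
generator `ψ`: its characteristic function is `t ↦ exp (i tᵀμ) ψ (tᵀ S t)`, and `ψ 0 = 1`. -/
structure IsElliptical {n : ℕ} (Q : Measure (EuclideanSpace ℝ (Fin n)))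
    (μ : EuclideanSpace ℝ (Fin n)) (S : Matrix (Fin n) (Fin n) ℝ) (ψ : ℝ → ℝ) : Prop where
  generator_zero : ψ 0 = 1
  charFun_eq : ∀ t : EuclideanSpace ℝ (Fin n),
    charFun Q t = Complex.exp (Complex.I * (inner ℝ t μ : ℝ)) * (ψ (quadForm S t) : ℂ)

/-- The normalizing constant `cₙ = Γ(n/2) / π^(n/2) · (∫₀^∞ z^(n/2-1) g(z) dz)⁻¹`. -/
noncomputable def normConst (n : ℕ) (g : ℝ → ℝ) : ℝ :=
  Real.Gamma ((n : ℝ) / 2) / Real.pi ^ ((n : ℝ) / 2) *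
    (∫ z in Set.Ioi (0 : ℝ), z ^ ((n : ℝ) / 2 - 1) * g z)⁻¹

/-- `g : [0, ∞) → [0, ∞)` is a density generator in dimension `n`:
`0 < ∫₀^∞ z^(n/2-1) g(z) dz < ∞`. (Only the values of `g` on `[0, ∞)` are relevant.) -/
structure IsDensityGenerator (n : ℕ) (g : ℝ → ℝ) : Prop where
  measurable : Measurable g
  nonneg : ∀ u : ℝ, 0 ≤ u → 0 ≤ g u
  integrable : IntegrableOn (fun z : ℝ => z ^ ((n : ℝ) / 2 - 1) * g z) (Set.Ioi 0)
  integral_pos : 0 < ∫ z in Set.Ioi (0 : ℝ), z ^ ((n : ℝ) / 2 - 1) * g z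

/-- The law `Q` on `ℝⁿ` has the elliptical Lebesgue density
`x ↦ cₙ / √|S| · g ((x - μ)ᵀ S⁻¹ (x - μ))`, with density generator `g`. -/
structure HasDensityGenerator {n : ℕ} (Q : Measure (EuclideanSpace ℝ (Fin n)))
    (μ : EuclideanSpace ℝ (Fin n)) (S : Matrix (Fin n) (Fin n) ℝ) (g : ℝ → ℝ) : Prop where
  isDensityGenerator : IsDensityGenerator n g
  law_eq : Q = (volume : Measure (EuclideanSpace ℝ (Fin n))).withDensity
    (fun x => ENNReal.ofReal
      (normConst n g / Real.sqrt |S.det| * g (quadForm S⁻¹ (x - μ))))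

/-- `Y ∼ LSEₙ(μ, S, δ, g, α, β, H)`, where `H` is the law of the mixing vector:
`S` is positive definite and `Y` has the same distribution as `μ + α(Z) X + β(Z) δ`, where `X` is
elliptical with location `0`, scale matrix `S` and density generator `g`, `Z` has law `H`, and
`X`, `Z` are independent. -/
def IsLSE {Ω : Type*} [MeasurableSpace Ω] {n q : ℕ}
    (Y : Ω → EuclideanSpace ℝ (Fin n)) (P : Measure Ω)
    (μ : EuclideanSpace ℝ (Fin n)) (S : Matrix (Fin n) (Fin n) ℝ)
    (δ : EuclideanSpace ℝ (Fin n)) (g : ℝ → ℝ)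
    (α β : EuclideanSpace ℝ (Fin q) → ℝ) (H : Measure (EuclideanSpace ℝ (Fin q))) : Prop :=
  S.PosDef ∧
  ∃ (Ω' : Type) (_ : MeasurableSpace Ω') (P' : Measure Ω')
    (X : Ω' → EuclideanSpace ℝ (Fin n)) (Z : Ω' → EuclideanSpace ℝ (Fin q))
    (Q : Measure (EuclideanSpace ℝ (Fin n))) (ψ : ℝ → ℝ),
    IsProbabilityMeasure P' ∧
    IsElliptical Q 0 S ψ ∧ HasDensityGenerator Q 0 S g ∧
    HasLaw X Q P' ∧ HasLaw Z H P' ∧ IndepFun X Z P' ∧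
    IdentDistrib Y (fun ω => μ + α (Z ω) • X ω + β (Z ω) • δ) P P'

/-- The difference operator `Δᵢ^ε f (x) = f (x + ε eᵢ) - f x`. -/
noncomputable def diffOp {n : ℕ} (i : Fin n) (ε : ℝ) (f : EuclideanSpace ℝ (Fin n) → ℝ) :
    EuclideanSpace ℝ (Fin n) → ℝ :=
  fun x => f (x + EuclideanSpace.single i ε) - f x

/-- `f` is directionally convex: `Δᵢ^ε₁ Δⱼ^ε₂ f ≥ 0` for all `i`, `j` (also `i = j`) and
`ε₁, ε₂ ≥ 0`. -/
def IsDirectionallyConvex {n : ℕ} (f : EuclideanSpace ℝ (Fin n) → ℝ) : Prop :=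
  ∀ (i j : Fin n) (ε₁ ε₂ : ℝ), 0 ≤ ε₁ → 0 ≤ ε₂ →
    ∀ x : EuclideanSpace ℝ (Fin n), 0 ≤ diffOp i ε₁ (diffOp j ε₂ f) x

/-- The expectation of `h` is well defined (possibly infinite): the positive part or the negative
part of `h` has a finite integral. -/
def HasExpectation {Ω : Type*} [MeasurableSpace Ω] (h : Ω → ℝ) (P : Measure Ω) : Prop :=
  (∫⁻ ω, ENNReal.ofReal (h ω) ∂P) ≠ ⊤ ∨ (∫⁻ ω, ENNReal.ofReal (-h ω) ∂P) ≠ ⊤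

/-- The expectation `E h = E h⁺ - E h⁻` in `[-∞, ∞]`; meaningful when `HasExpectation h P`. -/
noncomputable def extExpectation {Ω : Type*} [MeasurableSpace Ω] (h : Ω → ℝ) (P : Measure Ω) :
    EReal :=
  ((∫⁻ ω, ENNReal.ofReal (h ω) ∂P : ℝ≥0∞) : EReal) -
    ((∫⁻ ω, ENNReal.ofReal (-h ω) ∂P : ℝ≥0∞) : EReal)

/-- The directionally convex order `Y₁ ≤_dcx Y₂`: `E f(Y₁) ≤ E f(Y₂)` for all measurable
directionally convex `f` for which both expectations are well defined. -/
def DcxLE {Ω₁ Ω₂ : Type*} [MeasurableSpace Ω₁] [MeasurableSpace Ω₂] {n : ℕ}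
    (Y₁ : Ω₁ → EuclideanSpace ℝ (Fin n)) (P₁ : Measure Ω₁)
    (Y₂ : Ω₂ → EuclideanSpace ℝ (Fin n)) (P₂ : Measure Ω₂) : Prop :=
  ∀ f : EuclideanSpace ℝ (Fin n) → ℝ, Measurable f → IsDirectionallyConvex f →
    HasExpectation (fun ω => f (Y₁ ω)) P₁ → HasExpectation (fun ω => f (Y₂ ω)) P₂ →
      extExpectation (fun ω => f (Y₁ ω)) P₁ ≤ extExpectation (fun ω => f (Y₂ ω)) P₂

/-! The law of `Y` is that of `b(z) + α(z) A u`, with `b(z) = μ + β(z) δ`, `A Aᵀ = S`, and `(u, z)`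
drawn from the product of one fixed spherical law and `H`. Rotation invariance of `u` makes `E f`
depend on `A` only through `A Aᵀ`.

Sufficiency rests on one elementary move. If `A w = x eᵢ - y eⱼ` with `w` a unit vector and `x, y ≥
0`, averaging over `u` and its reflection in the hyperplane `w⊥` places two points symmetrically
about a base point along `± s (x eᵢ - y eⱼ)`. Directional convexity, as a four-point inequality,
says that turning this diagonal into `± s (x eᵢ + y eⱼ)` increases the sum of the values of `f`. The
turned configuration belongs to `B = A + 2 y eⱼ wᵀ`, and `B Bᵀ = A Aᵀ + 2xy (Eᵢⱼ + Eⱼᵢ)`. A suitable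
`w` exists whenever `2xy` is at most a lower bound for the spectrum of `S`
(`exists_unit_mulVec_eq`). Positive definiteness is uniform along the segment from `S₁` to `S₂`, so
finitely many such moves join them (`IsRotationInvariant.mixtureLE_of_le`). No smoothness of `f` is
needed. Integrability comes from truncating to bounded regions, where a measurable directionally
convex `f` is bounded; monotone convergence then removes the truncation
(`IsRotationInvariant.lintegral_add_le`).

Necessity uses the test functions `± xᵢ` and `xᵢ xⱼ`. The former force equal means, hence `δ₁ = δ₂`
or `μ₁ = μ₂`. The shifts then agree, and the second moments differ only in the term `m Sᵢⱼ` with a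
common `m > 0`. -/

/-! ### Directionally convex functions: four-point inequality and local boundedness. -/

section DirectionallyConvex

variable {n : ℕ}

lemma le_add_of_le_add_single {F : EuclideanSpace ℝ (Fin n) → ℝ}
    (hF : ∀ i ε, 0 ≤ ε → ∀ x, F x ≤ F (x + EuclideanSpace.single i ε))
    (x h : EuclideanSpace ℝ (Fin n)) (hh : ∀ i, 0 ≤ h i) : F x ≤ F (x + h) := by
  have key : ∀ s : Finset (Fin n), F x ≤ F (x + ∑ i ∈ s, EuclideanSpace.single i (h i)) := by
    intro s
    induction s using Finset.induction_on with
    | empty => simp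
    | insert i s hi ih =>
      rw [Finset.sum_insert hi, add_comm (EuclideanSpace.single i (h i)), ← add_assoc]
      exact ih.trans (hF i _ (hh i) _)
  have hsum : ∑ i, EuclideanSpace.single i (h i) = h := by
    ext k
    simp [Finset.sum_apply, Pi.single_apply]
  simpa [hsum] using key Finset.univ

/-- The definition says that `diffOp j ε f` is monotone along each axis, hence along the positive
orthant. Exchanging the two increments and repeating the argument replaces the axis step by an
arbitrary `k ≥ 0`. -/
lemma IsDirectionallyConvex.four_point {f : EuclideanSpace ℝ (Fin n) → ℝ}
    (hf : IsDirectionallyConvex f) (x h k : EuclideanSpace ℝ (Fin n))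
    (hh : ∀ i, 0 ≤ h i) (hk : ∀ i, 0 ≤ k i) :
    f (x + h) + f (x + k) ≤ f x + f (x + h + k) := by
  have h1 : ∀ j ε, 0 ≤ ε → ∀ x h : EuclideanSpace ℝ (Fin n), (∀ i, 0 ≤ h i) →
      f (x + h) + f (x + EuclideanSpace.single j ε) ≤
        f x + f (x + EuclideanSpace.single j ε + h) := by
    intro j ε hε x h hh
    have := le_add_of_le_add_single (F := diffOp j ε f) (fun i ε' hε' x => by
      have := hf i j ε' ε hε' hε x
      rw [diffOp] at this
      linarith) x h hh
    simp only [diffOp] at this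
    rw [add_right_comm x h] at this
    linarith
  have := le_add_of_le_add_single (F := fun x => f (x + h) - f x) (fun j ε hε x => by
      have := h1 j ε hε x h hh
      linarith) x k hk
  rw [add_right_comm x k] at this
  linarith

lemma IsDirectionallyConvex.two_mul_le {f : EuclideanSpace ℝ (Fin n) → ℝ}
    (hf : IsDirectionallyConvex f) (x h : EuclideanSpace ℝ (Fin n)) (hh : ∀ i, 0 ≤ h i) :
    2 * f x ≤ f (x - h) + f (x + h) := by
  have := hf.four_point (x - h) h h hh hh
  simp only [sub_add_cancel] at this
  linarith

/-- If `f x ≥ M`, midpoint convexity along each `h ≥ 0` forces `f ≥ M` at `x + h` or `x - h`. Hence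
`{f ≥ M}` fills at least half the volume of the orthant piece `B` inside a fixed ball. Were this so
for every `M`, the sets would have to shrink to the empty set without their volumes tending to zero.
-/
lemma IsDirectionallyConvex.bddAbove_closedBall {f : EuclideanSpace ℝ (Fin n) → ℝ}
    (hf : IsDirectionallyConvex f) (hm : Measurable f) (r : ℝ) :
    ∃ M, ∀ x, ‖x‖ ≤ r → f x ≤ M := by
  by_contra! hcon
  set B : Set (EuclideanSpace ℝ (Fin n)) := {h | (∀ i, 0 ≤ h i) ∧ ‖h‖ < 1} with hB
  set C : Set (EuclideanSpace ℝ (Fin n)) := Metric.closedBall 0 (r + 1) with hC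
  have hBmeas : MeasurableSet B := by
    have : B = (⋂ i, {h : EuclideanSpace ℝ (Fin n) | 0 ≤ h i}) ∩ Metric.ball 0 1 := by
      ext h; simp [hB]
    rw [this]
    exact (MeasurableSet.iInter fun i => measurableSet_le measurable_const (by fun_prop)).inter
      Metric.isOpen_ball.measurableSet
  have hBpos : 0 < volume B := by
    have hsub : {h : EuclideanSpace ℝ (Fin n) | (∀ i, 0 < h i) ∧ ‖h‖ < 1} ⊆ B :=
      fun h hh => ⟨fun i => (hh.1 i).le, hh.2⟩
    refine lt_of_lt_of_le ?_ (measure_mono hsub)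
    refine IsOpen.measure_pos _ ?_ ?_
    · have : {h : EuclideanSpace ℝ (Fin n) | (∀ i, 0 < h i) ∧ ‖h‖ < 1} =
          (⋂ i, {h : EuclideanSpace ℝ (Fin n) | 0 < h i}) ∩ Metric.ball 0 1 := by
        ext h; simp
      rw [this]
      exact (isOpen_iInter_of_finite fun i => isOpen_lt continuous_const (by fun_prop)).inter
        Metric.isOpen_ball
    · set o : EuclideanSpace ℝ (Fin n) := WithLp.toLp 2 (fun _ => 1) with ho
      have hpos : 0 < ‖o‖ + 1 := by positivity
      refine ⟨(‖o‖ + 1)⁻¹ • o, fun i => ?_, ?_⟩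
      · simp [ho]; positivity
      · rw [norm_smul, norm_inv, Real.norm_of_nonneg hpos.le, inv_mul_lt_iff₀ hpos]
        linarith
  have hlow : ∀ M : ℝ, volume B ≤ 2 * volume ({x | M ≤ f x} ∩ C) := by
    intro M
    obtain ⟨x, hx, hMx⟩ := hcon M
    set T := {x | M ≤ f x} ∩ C with hT
    have hcov : B ⊆ (fun h => x + h) ⁻¹' T ∪ (fun h => x - h) ⁻¹' T := by
      rintro h ⟨hh, hn⟩
      have h2 := hf.two_mul_le x h hh
      by_cases hc : M ≤ f (x + h)
      · left
        refine ⟨hc, ?_⟩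
        rw [hC, mem_closedBall_zero_iff]
        linarith [norm_add_le x h]
      · right
        refine ⟨?_, ?_⟩
        · show M ≤ f (x - h)
          push Not at hc
          linarith
        · rw [hC, mem_closedBall_zero_iff]
          linarith [norm_sub_le x h]
    refine (measure_mono hcov).trans ((measure_union_le _ _).trans ?_)
    have hTm : MeasurableSet T := (measurableSet_le measurable_const hm).inter
      Metric.isClosed_closedBall.measurableSet
    rw [measure_preimage_add, two_mul]
    refine _root_.add_le_add le_rfl (le_of_eq ?_)
    exact (Measure.measurePreserving_sub_left volume x).measure_preimage hTm.nullMeasurableSet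
  have hlim : Filter.Tendsto (fun k : ℕ => volume ({x | (k : ℝ) ≤ f x} ∩ C)) Filter.atTop
      (nhds (volume (⋂ k : ℕ, ({x | (k : ℝ) ≤ f x} ∩ C)))) := by
    refine tendsto_measure_iInter_atTop (fun k => ?_) ?_ ?_
    · exact ((measurableSet_le measurable_const hm).inter
        Metric.isClosed_closedBall.measurableSet).nullMeasurableSet
    · intro a b hab x hx
      exact ⟨le_trans (Nat.cast_le.2 hab) (show (b : ℝ) ≤ f x from hx.1), hx.2⟩
    · exact ⟨0, ((measure_mono Set.inter_subset_right).trans_lt measure_closedBall_lt_top).ne⟩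
  have hempty : (⋂ k : ℕ, ({x | (k : ℝ) ≤ f x} ∩ C)) = ∅ := by
    ext x
    simp only [Set.mem_iInter, Set.mem_empty_iff_false, iff_false]
    intro hx
    obtain ⟨k, hk⟩ := exists_nat_gt (f x)
    exact absurd (hx k).1 (not_le.2 hk)
  rw [hempty, measure_empty] at hlim
  have h2 := ENNReal.Tendsto.const_mul (a := 2) hlim (Or.inr (by norm_num))
  rw [mul_zero] at h2
  exact absurd (ge_of_tendsto' h2 fun k => hlow k) (not_le.2 hBpos)

lemma IsDirectionallyConvex.exists_abs_le {f : EuclideanSpace ℝ (Fin n) → ℝ}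
    (hf : IsDirectionallyConvex f) (hm : Measurable f) (r : ℝ) :
    ∃ M, ∀ x, ‖x‖ ≤ r → |f x| ≤ M := by
  -- The point `o` dominates every `x` of the ball coordinatewise, so `2 f(o) ≤ f(x) + f(2o - x)`
  -- turns the upper bound at `2o - x` into a lower bound at `x`.
  set o : EuclideanSpace ℝ (Fin n) := WithLp.toLp 2 (fun _ => r) with ho
  obtain ⟨M, hM⟩ := hf.bddAbove_closedBall hm (r + ‖o‖ + ‖o‖)
  refine ⟨max M (M - 2 * f o), fun x hx => abs_le.2 ⟨?_, ?_⟩⟩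
  · have h1 := hf.two_mul_le o (o - x) (fun i => by
      have := (Real.norm_eq_abs (x i) ▸ PiLp.norm_apply_le x i : |x i| ≤ ‖x‖)
      simp only [ho, PiLp.sub_apply]
      linarith [le_abs_self (x i)])
    have h2 : f (o + (o - x)) ≤ M := hM _ (by
      linarith [norm_add_le o (o - x), norm_sub_le o x])
    rw [sub_sub_cancel] at h1
    linarith [le_max_right M (M - 2 * f o)]
  · exact (hM x (by linarith [norm_nonneg o])).trans (le_max_left _ _)

end DirectionallyConvex

/-! ### Rotation-invariant mixtures and the elementary rank-one move. -/

/-- The linear map `u ↦ A u` on Euclidean space. -/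
noncomputable abbrev euclideanMap {n : ℕ} (A : Matrix (Fin n) (Fin n) ℝ) :
    EuclideanSpace ℝ (Fin n) →L[ℝ] EuclideanSpace ℝ (Fin n) :=
  Matrix.toEuclideanCLM (n := Fin n) (𝕜 := ℝ) A

/-- `π` is invariant under orthogonal transformations of the first component. -/
def IsRotationInvariant {n : ℕ} {ζ : Type*} [MeasurableSpace ζ]
    (π : Measure (EuclideanSpace ℝ (Fin n) × ζ)) : Prop :=
  ∀ Q : Matrix (Fin n) (Fin n) ℝ, Q * Qᵀ = 1 →
    MeasurePreserving (fun p : EuclideanSpace ℝ (Fin n) × ζ => (euclideanMap Q p.1, p.2)) π π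

/-- The integral of `f (b z + a z • A u)` with respect to `π (du, dz)`. -/
noncomputable def mixtureIntegral {n : ℕ} {ζ : Type*} [MeasurableSpace ζ]
    (π : Measure (EuclideanSpace ℝ (Fin n) × ζ)) (b : ζ → EuclideanSpace ℝ (Fin n)) (a : ζ → ℝ)
    (f : EuclideanSpace ℝ (Fin n) → ℝ) (A : Matrix (Fin n) (Fin n) ℝ) : ℝ :=
  ∫ p, f (b p.2 + a p.2 • euclideanMap A p.1) ∂π

section OneStep

variable {n : ℕ} {ζ : Type*} [MeasurableSpace ζ]
  {π : Measure (EuclideanSpace ℝ (Fin n) × ζ)} {b : ζ → EuclideanSpace ℝ (Fin n)} {a : ζ → ℝ}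
  {f : EuclideanSpace ℝ (Fin n) → ℝ}

/-- The four points are the corners of the parallelogram based at `p - c (v + v')` with sides `2c v`
and `2c v'`. A negative `c` only swaps the two terms on each side. -/
lemma IsDirectionallyConvex.sub_single_add_le (hf : IsDirectionallyConvex f)
    (p : EuclideanSpace ℝ (Fin n)) (i j : Fin n) {x y : ℝ} (hx : 0 ≤ x) (hy : 0 ≤ y) (c : ℝ) :
    f (p + c • (EuclideanSpace.single i x - EuclideanSpace.single j y)) +
        f (p - c • (EuclideanSpace.single i x - EuclideanSpace.single j y)) ≤
      f (p + c • (EuclideanSpace.single i x + EuclideanSpace.single j y)) +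
        f (p - c • (EuclideanSpace.single i x + EuclideanSpace.single j y)) := by
  have main : ∀ c : ℝ, 0 ≤ c →
    f (p + c • (EuclideanSpace.single i x - EuclideanSpace.single j y)) +
        f (p - c • (EuclideanSpace.single i x - EuclideanSpace.single j y)) ≤
      f (p + c • (EuclideanSpace.single i x + EuclideanSpace.single j y)) +
        f (p - c • (EuclideanSpace.single i x + EuclideanSpace.single j y)) := by
    intro c hc
    set v : EuclideanSpace ℝ (Fin n) := EuclideanSpace.single i x with hv
    set v' : EuclideanSpace ℝ (Fin n) := EuclideanSpace.single j y with hv'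
    have key := hf.four_point (p - c • (v + v')) ((2 * c) • v) ((2 * c) • v')
      (fun k => by
        rw [PiLp.smul_apply, hv, PiLp.single_apply]
        split_ifs
        · simp; positivity
        · simp)
      (fun k => by
        rw [PiLp.smul_apply, hv', PiLp.single_apply]
        split_ifs
        · simp; positivity
        · simp)
    have e1 : p - c • (v + v') + (2 * c) • v = p + c • (v - v') := by module
    have e2 : p - c • (v + v') + (2 * c) • v' = p - c • (v - v') := by module
    have e3 : p + c • (v - v') + (2 * c) • v' = p + c • (v + v') := by module
    rw [e1, e2, e3] at key
    linarith
  rcases le_total 0 c with hc | hc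
  · exact main c hc
  · have := main (-c) (by linarith)
    simp only [neg_smul, sub_neg_eq_add, ← sub_eq_add_neg] at this
    linarith

lemma IsRotationInvariant.mixtureIntegral_mul (hπ : IsRotationInvariant π)
    (hf : Measurable f) (hb : Measurable b) (ha : Measurable a)
    {Q : Matrix (Fin n) (Fin n) ℝ} (hQ : Q * Qᵀ = 1) (A : Matrix (Fin n) (Fin n) ℝ) :
    mixtureIntegral π b a f (A * Q) = mixtureIntegral π b a f A := by
  have h := hπ Q hQ
  have hm : Measurable fun p : EuclideanSpace ℝ (Fin n) × ζ =>
      f (b p.2 + a p.2 • euclideanMap A p.1) := by fun_prop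
  unfold mixtureIntegral
  conv_rhs => rw [← h.map_eq, integral_map h.aemeasurable hm.aestronglyMeasurable]
  simp [euclideanMap]

/-- Two factors of the same invertible matrix differ by the orthogonal matrix `A⁻¹ A'`. -/
lemma IsRotationInvariant.mixtureIntegral_congr (hπ : IsRotationInvariant π)
    (hf : Measurable f) (hb : Measurable b) (ha : Measurable a)
    {A A' : Matrix (Fin n) (Fin n) ℝ} (hA : IsUnit A.det) (h : A * Aᵀ = A' * A'ᵀ) :
    mixtureIntegral π b a f A = mixtureIntegral π b a f A' := by
  have hQ : (A⁻¹ * A') * (A⁻¹ * A')ᵀ = 1 := by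
    rw [Matrix.transpose_mul, Matrix.mul_assoc, ← Matrix.mul_assoc A', ← h,
      ← Matrix.mul_assoc, ← Matrix.mul_assoc, Matrix.nonsing_inv_mul _ hA, Matrix.one_mul,
      ← Matrix.transpose_mul, Matrix.nonsing_inv_mul _ hA, Matrix.transpose_one]
  have := hπ.mixtureIntegral_mul hf hb ha hQ A
  rwa [← Matrix.mul_assoc, Matrix.mul_nonsing_inv _ hA, Matrix.one_mul, eq_comm] at this

lemma householder_mul_transpose {w : Fin n → ℝ} (hw : w ⬝ᵥ w = 1) :
    (1 - (2 : ℝ) • Matrix.vecMulVec w w) * (1 - (2 : ℝ) • Matrix.vecMulVec w w)ᵀ = 1 := by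
  rw [Matrix.transpose_sub, Matrix.transpose_smul, Matrix.transpose_vecMulVec,
    Matrix.transpose_one, Matrix.sub_mul, Matrix.one_mul, Matrix.smul_mul, Matrix.mul_sub,
    Matrix.mul_one, Matrix.mul_smul, Matrix.vecMulVec_mul_vecMulVec, hw, one_smul]
  module

lemma euclideanMap_add_vecMulVec (A : Matrix (Fin n) (Fin n) ℝ) (c : ℝ) (v w : Fin n → ℝ)
    (u : EuclideanSpace ℝ (Fin n)) :
    euclideanMap (A + c • Matrix.vecMulVec v w) u =
      euclideanMap A u + (c * (w ⬝ᵥ u.ofLp)) • WithLp.toLp 2 v := by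
  ext k
  simp [Matrix.vecMulVec_mulVec]
  ring

lemma euclideanMap_sub_vecMulVec (A : Matrix (Fin n) (Fin n) ℝ) (c : ℝ) (v w : Fin n → ℝ)
    (u : EuclideanSpace ℝ (Fin n)) :
    euclideanMap (A - c • Matrix.vecMulVec v w) u =
      euclideanMap A u - (c * (w ⬝ᵥ u.ofLp)) • WithLp.toLp 2 v := by
  rw [sub_eq_add_neg, ← neg_smul, euclideanMap_add_vecMulVec, neg_mul, neg_smul, sub_eq_add_neg]

/-- If `A w = x eᵢ - y eⱼ` for a unit vector `w`, the rank one update `A + 2 y eⱼ wᵀ` increases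
the mixture integral of a directionally convex function. -/
lemma IsRotationInvariant.mixtureIntegral_le_update (hπ : IsRotationInvariant π)
    (hfm : Measurable f) (hb : Measurable b) (ha : Measurable a) (hf : IsDirectionallyConvex f)
    (hint : ∀ A, Integrable (fun p : EuclideanSpace ℝ (Fin n) × ζ =>
      f (b p.2 + a p.2 • euclideanMap A p.1)) π)
    {A : Matrix (Fin n) (Fin n) ℝ} {w : Fin n → ℝ} (hw : w ⬝ᵥ w = 1) {i j : Fin n} {x y : ℝ}
    (hx : 0 ≤ x) (hy : 0 ≤ y) (hA : A *ᵥ w = Pi.single i x - Pi.single j y) :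
    mixtureIntegral π b a f A ≤
      mixtureIntegral π b a f (A + (2 : ℝ) • Matrix.vecMulVec (Pi.single j y) w) := by
  set ρ : Matrix (Fin n) (Fin n) ℝ := 1 - (2 : ℝ) • Matrix.vecMulVec w w with hρ
  set B := A + (2 : ℝ) • Matrix.vecMulVec (Pi.single j y) w with hB
  have hρρ : ρ * ρᵀ = 1 := householder_mul_transpose hw
  have h1 := hπ.mixtureIntegral_mul hfm hb ha hρρ A
  have h2 := hπ.mixtureIntegral_mul hfm hb ha hρρ B
  have hAρ : A * ρ = A - (2 : ℝ) • Matrix.vecMulVec (Pi.single i x - Pi.single j y) w := by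
    rw [hρ, Matrix.mul_sub, Matrix.mul_one, Matrix.mul_smul, Matrix.mul_vecMulVec, hA]
  have hBρ : B * ρ = A - (2 : ℝ) • Matrix.vecMulVec (Pi.single i x) w := by
    rw [hB, Matrix.add_mul, hAρ, hρ, Matrix.mul_sub, Matrix.mul_one, Matrix.mul_smul,
      Matrix.smul_mul, Matrix.vecMulVec_mul_vecMulVec, hw, one_smul, Matrix.sub_vecMulVec]
    module
  have hle : mixtureIntegral π b a f A + mixtureIntegral π b a f (A * ρ) ≤
      mixtureIntegral π b a f B + mixtureIntegral π b a f (B * ρ) := by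
    unfold mixtureIntegral
    rw [← integral_add (hint _) (hint _), ← integral_add (hint _) (hint _)]
    refine integral_mono ((hint _).add (hint _)) ((hint _).add (hint _)) fun p => ?_
    -- Here `s` is the component of `u` along `w`. The reflection `ρ` flips its sign and fixes the
    -- rest of `u`, so all four points share the base point obtained by removing `s A w`.
    set s := w ⬝ᵥ p.1.ofLp with hs
    have key := hf.sub_single_add_le (b p.2 + a p.2 • (euclideanMap A p.1 -
      s • (EuclideanSpace.single i x - EuclideanSpace.single j y))) i j hx hy (a p.2 * s)
    have eA : b p.2 + a p.2 • euclideanMap A p.1 = (b p.2 + a p.2 • (euclideanMap A p.1 -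
      s • (EuclideanSpace.single i x - EuclideanSpace.single j y))) +
      (a p.2 * s) • (EuclideanSpace.single i x - EuclideanSpace.single j y) := by module
    have eAρ : b p.2 + a p.2 • euclideanMap (A * ρ) p.1 =
      (b p.2 + a p.2 • (euclideanMap A p.1 -
      s • (EuclideanSpace.single i x - EuclideanSpace.single j y))) -
      (a p.2 * s) • (EuclideanSpace.single i x - EuclideanSpace.single j y) := by
      rw [hAρ, euclideanMap_sub_vecMulVec, ← hs, WithLp.toLp_sub, PiLp.toLp_single,
        PiLp.toLp_single]
      module
    have eB : b p.2 + a p.2 • euclideanMap B p.1 = (b p.2 + a p.2 • (euclideanMap A p.1 -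
      s • (EuclideanSpace.single i x - EuclideanSpace.single j y))) +
      (a p.2 * s) • (EuclideanSpace.single i x + EuclideanSpace.single j y) := by
      rw [hB, euclideanMap_add_vecMulVec, ← hs, PiLp.toLp_single]
      module
    have eBρ : b p.2 + a p.2 • euclideanMap (B * ρ) p.1 =
      (b p.2 + a p.2 • (euclideanMap A p.1 -
      s • (EuclideanSpace.single i x - EuclideanSpace.single j y))) -
      (a p.2 * s) • (EuclideanSpace.single i x + EuclideanSpace.single j y) := by
      rw [hBρ, euclideanMap_sub_vecMulVec, ← hs, PiLp.toLp_single]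
      module
    simp only
    rw [eAρ, eB, eBρ, eA]
    exact key
  linarith

/-- The cross terms contribute `-4y² Eⱼⱼ`, which cancels the square of the rank-one term; only the
`xy` part survives. This covers `i = j` as well. -/
lemma update_mul_transpose {A : Matrix (Fin n) (Fin n) ℝ} {w : Fin n → ℝ} (hw : w ⬝ᵥ w = 1)
    {i j : Fin n} {x y : ℝ} (hA : A *ᵥ w = Pi.single i x - Pi.single j y) :
    (A + (2 : ℝ) • Matrix.vecMulVec (Pi.single j y) w) *
        (A + (2 : ℝ) • Matrix.vecMulVec (Pi.single j y) w)ᵀ =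
      A * Aᵀ + (2 * (x * y)) • (Matrix.single i j 1 + Matrix.single j i 1) := by
  have hs : ∀ (i j : Fin n) (x y : ℝ), Matrix.single i j (x * y) =
      Matrix.vecMulVec (Pi.single i x) (Pi.single j y) := by
    intro i j x y
    ext k l
    simp only [Matrix.single_apply, Matrix.vecMulVec_apply, Pi.single_apply, eq_comm (b := k),
      eq_comm (b := l)]
    split_ifs <;> simp_all
  have h1 := hs i j x y
  have h2 := hs j i y x
  rw [mul_comm] at h2
  have hA' : w ᵥ* Aᵀ = Pi.single i x - Pi.single j y := by rw [Matrix.vecMul_transpose, hA]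
  have h3 : (2 * (x * y)) • (Matrix.single i j (1 : ℝ) + Matrix.single j i 1) =
      (2 : ℝ) • (Matrix.single i j (x * y) + Matrix.single j i (x * y)) := by
    rw [mul_smul, smul_add (x * y), Matrix.smul_single, Matrix.smul_single, smul_eq_mul, mul_one]
  rw [h3, h1, h2, Matrix.transpose_add, Matrix.transpose_smul, Matrix.transpose_vecMulVec,
    Matrix.add_mul, Matrix.mul_add, Matrix.mul_add, Matrix.mul_smul, Matrix.smul_mul,
    Matrix.smul_mul, Matrix.mul_smul, Matrix.mul_vecMulVec, hA, Matrix.vecMulVec_mul, hA',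
    Matrix.vecMulVec_mul_vecMulVec, hw, one_smul, Matrix.sub_vecMulVec, Matrix.vecMulVec_sub]
  module

end OneStep

/-! ### Factors of positive definite matrices and the choice of the unit vector. -/

section Factorization

variable {n : ℕ} {S : Matrix (Fin n) (Fin n) ℝ}

open scoped MatrixOrder in
lemma Matrix.PosDef.exists_mul_transpose (hS : S.PosDef) :
    ∃ A : Matrix (Fin n) (Fin n) ℝ, A * Aᵀ = S := by
  obtain ⟨B, hB⟩ := CStarAlgebra.nonneg_iff_eq_star_mul_self.mp
    hS.posSemidef.nonneg
  refine ⟨Bᵀ, ?_⟩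
  rw [hB, Matrix.transpose_transpose, Matrix.star_eq_conjTranspose,
    Matrix.conjTranspose_eq_transpose_of_trivial]

lemma Matrix.PosDef.isUnit_det_of_mul_transpose (hS : S.PosDef) {A : Matrix (Fin n) (Fin n) ℝ}
    (h : A * Aᵀ = S) : IsUnit A.det := by
  have := hS.det_pos
  rw [← h, Matrix.det_mul] at this
  exact isUnit_iff_ne_zero.2 fun h0 => by simp [h0] at this

lemma dotProduct_mul_transpose_mulVec (A : Matrix (Fin n) (Fin n) ℝ) (x : Fin n → ℝ) :
    x ⬝ᵥ ((A * Aᵀ) *ᵥ x) = (Aᵀ *ᵥ x) ⬝ᵥ (Aᵀ *ᵥ x) := by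
  rw [← Matrix.mulVec_mulVec, Matrix.dotProduct_mulVec, Matrix.mulVec_transpose]

lemma dotProduct_self_eq_norm_sq (x : Fin n → ℝ) : x ⬝ᵥ x = ‖WithLp.toLp 2 x‖ ^ 2 := by
  rw [EuclideanSpace.real_norm_sq_eq]
  simp [dotProduct, sq]

lemma dotProduct_sq_le (x y : Fin n → ℝ) : (x ⬝ᵥ y) ^ 2 ≤ (x ⬝ᵥ x) * (y ⬝ᵥ y) := by
  simpa [dotProduct, sq] using Finset.sum_mul_sq_le_sq_mul_sq Finset.univ x y

lemma Matrix.PosDef.exists_pos_forall_le (hS : S.PosDef) :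
    ∃ c > 0, ∀ x : Fin n → ℝ, c * (x ⬝ᵥ x) ≤ x ⬝ᵥ (S *ᵥ x) := by
  obtain ⟨A, hA⟩ := hS.exists_mul_transpose
  have hdet := hS.isUnit_det_of_mul_transpose hA
  set B := (A⁻¹)ᵀ with hB
  refine ⟨(‖euclideanMap B‖ ^ 2 + 1)⁻¹, by positivity, fun x => ?_⟩
  have hx : B *ᵥ (Aᵀ *ᵥ x) = x := by
    rw [Matrix.mulVec_mulVec, hB, ← Matrix.transpose_mul, Matrix.mul_nonsing_inv _ hdet,
      Matrix.transpose_one, Matrix.one_mulVec]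
  rw [← hA, dotProduct_mul_transpose_mulVec, inv_mul_le_iff₀ (by positivity),
    dotProduct_self_eq_norm_sq, dotProduct_self_eq_norm_sq]
  have h1 := (euclideanMap B).le_opNorm (WithLp.toLp 2 (Aᵀ *ᵥ x))
  rw [Matrix.toEuclideanCLM_toLp, hx] at h1
  calc ‖WithLp.toLp 2 x‖ ^ 2 ≤ (‖euclideanMap B‖ * ‖WithLp.toLp 2 (Aᵀ *ᵥ x)‖) ^ 2 := by gcongr
    _ ≤ _ := by rw [mul_pow]; nlinarith [sq_nonneg ‖WithLp.toLp 2 (Aᵀ *ᵥ x)‖]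

lemma posDef_of_forall_le {c : ℝ} (hc : 0 < c) (hS : Sᵀ = S)
    (h : ∀ x : Fin n → ℝ, c * (x ⬝ᵥ x) ≤ x ⬝ᵥ (S *ᵥ x)) : S.PosDef := by
  refine Matrix.posDef_iff_dotProduct_mulVec.2 ⟨?_, fun {x} hx => ?_⟩
  · rw [Matrix.IsHermitian, Matrix.conjTranspose_eq_transpose_of_trivial, hS]
  · rw [star_trivial]
    have : 0 < x ⬝ᵥ x := by
      rw [dotProduct_self_eq_norm_sq]
      have : WithLp.toLp 2 x ≠ 0 := by simpa using hx
      positivity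
    exact (mul_pos hc this).trans_le (h x)

/-- The hypothesis bounds `Aᵀ` from below; this transfers the bound to `A`. Writing `w = Aᵀ y` gives
`|w|² = y · v`, and Cauchy–Schwarz with `c |y|² ≤ |w|²` finishes. -/
lemma mul_dotProduct_le_of_mulVec_eq {A : Matrix (Fin n) (Fin n) ℝ} (hA : IsUnit A.det) {c : ℝ}
    (h : ∀ x : Fin n → ℝ, c * (x ⬝ᵥ x) ≤ x ⬝ᵥ ((A * Aᵀ) *ᵥ x)) {v w : Fin n → ℝ}
    (hw : A *ᵥ w = v) : c * (w ⬝ᵥ w) ≤ v ⬝ᵥ v := by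
  set y := (A⁻¹)ᵀ *ᵥ w with hy
  have h1 : Aᵀ *ᵥ y = w := by
    rw [hy, Matrix.mulVec_mulVec, ← Matrix.transpose_mul, Matrix.nonsing_inv_mul _ hA,
      Matrix.transpose_one, Matrix.one_mulVec]
  have h2 : c * (y ⬝ᵥ y) ≤ w ⬝ᵥ w := by
    have := h y
    rwa [dotProduct_mul_transpose_mulVec, h1] at this
  have h3 : w ⬝ᵥ w = y ⬝ᵥ v := by
    conv_lhs => enter [1]; rw [← h1]
    rw [← hw, Matrix.dotProduct_mulVec, Matrix.mulVec_transpose]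
  have h4 := dotProduct_sq_le y v
  rw [← h3] at h4
  have hww : 0 ≤ w ⬝ᵥ w := by rw [dotProduct_self_eq_norm_sq]; positivity
  have hvv : 0 ≤ v ⬝ᵥ v := by rw [dotProduct_self_eq_norm_sq]; positivity
  rcases le_or_gt c 0 with hc | hc
  · nlinarith
  rcases hww.eq_or_lt with h0 | h0
  · rw [← h0]; simpa using hvv
  · have : (w ⬝ᵥ w) * (c * (w ⬝ᵥ w)) ≤ (w ⬝ᵥ w) * (v ⬝ᵥ v) := by nlinarith
    exact le_of_mul_le_mul_left this h0

/-- Cauchy–Schwarz for `w` and row `i` of `A`, whose squared norm is `(A Aᵀ)ᵢᵢ`. -/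
lemma sq_le_of_mulVec_eq {A : Matrix (Fin n) (Fin n) ℝ} {v w : Fin n → ℝ}
    (hw : A *ᵥ w = v) (i : Fin n) : v i ^ 2 ≤ (A * Aᵀ) i i * (w ⬝ᵥ w) := by
  have := dotProduct_sq_le (A i) w
  rw [← hw]
  exact this

/-- For small `t`, a preimage `w` of `x eᵢ - y eⱼ` with `2 x y = t` can be chosen of norm one. -/
lemma exists_unit_mulVec_eq {A : Matrix (Fin n) (Fin n) ℝ} (hA : IsUnit A.det) {c : ℝ}
    (h : ∀ x : Fin n → ℝ, c * (x ⬝ᵥ x) ≤ x ⬝ᵥ ((A * Aᵀ) *ᵥ x)) (i j : Fin n) {t : ℝ}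
    (ht : 0 < t) (htc : t ≤ c) :
    ∃ (x y : ℝ) (w : Fin n → ℝ), 0 ≤ x ∧ 0 ≤ y ∧ 2 * (x * y) = t ∧ w ⬝ᵥ w = 1 ∧
      A *ᵥ w = Pi.single i x - Pi.single j y := by
  set τ := t / 2 with hτ
  have hτ0 : 0 < τ := by positivity
  set r := Real.sqrt τ with hr
  have hr0 : 0 < r := Real.sqrt_pos.2 hτ0
  have hrr : r * r = τ := Real.mul_self_sqrt hτ0.le
  set m := Real.sqrt ((A * Aᵀ) i i) with hm
  have hm0 : 0 ≤ m := Real.sqrt_nonneg _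
  -- The constraint `2xy = t` leaves only `x` free, with `y = τ / x`. The squared norm `F x` of the
  -- preimage of `v x` is brought to `1` by the intermediate value theorem.
  set v : ℝ → Fin n → ℝ := fun x => Pi.single i x - Pi.single j (τ / x) with hv
  set F : ℝ → ℝ := fun x => (A⁻¹ *ᵥ v x) ⬝ᵥ (A⁻¹ *ᵥ v x) with hF
  have hAv : ∀ x, A *ᵥ (A⁻¹ *ᵥ v x) = v x := fun x => by
    rw [Matrix.mulVec_mulVec, Matrix.mul_nonsing_inv _ hA, Matrix.one_mulVec]
  -- At `x = y = r` one has `|v|² ≤ 2r² = t ≤ c` (and `v = 0` when `i = j`), so the preimage has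
  -- norm at most one.
  have hlow : F r ≤ 1 := by
    have h1 := mul_dotProduct_le_of_mulVec_eq hA h (hAv r)
    have h2 : v r ⬝ᵥ v r ≤ t := by
      have : τ / r = r := by rw [← hrr]; field_simp
      simp only [hv, this, dotProduct_sub, dotProduct_single]
      by_cases hij : i = j
      · subst hij; simp; linarith
      · simp [hij, Ne.symm hij]; linarith
    have h3 : c * F r ≤ c * 1 := by linarith
    exact le_of_mul_le_mul_left h3 (by linarith)
  have hS0 : 0 < (A * Aᵀ) i i := by
    have := h (Pi.single i 1)
    simp only [Matrix.mulVec_single_one, single_one_dotProduct, Pi.single_eq_same,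
      Matrix.col_apply, mul_one] at this
    linarith
  have hmm : m * m = (A * Aᵀ) i i := Real.mul_self_sqrt hS0.le
  -- Since `τ / (r + m) ≤ r`, the `i`-th entry of `v` is at least `m = √Sᵢᵢ` even when `i = j`.
  have hhigh : 1 ≤ F (r + m) := by
    have h1 := sq_le_of_mulVec_eq (hAv (r + m)) i
    have h2 : m ≤ v (r + m) i := by
      have h3 : τ / (r + m) ≤ r := by
        rw [div_le_iff₀ (by linarith), ← hrr]; nlinarith
      have h4 : (Pi.single j (τ / (r + m)) : Fin n → ℝ) i ≤ τ / (r + m) := by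
        rw [Pi.single_apply]
        split_ifs
        · exact le_rfl
        · positivity
      simp only [hv, Pi.sub_apply, Pi.single_eq_same]
      linarith
    have h5 : (A * Aᵀ) i i * 1 ≤ (A * Aᵀ) i i * F (r + m) := by
      refine le_trans ?_ h1
      rw [mul_one, ← hmm, sq]
      exact mul_self_le_mul_self hm0 h2
    exact le_of_mul_le_mul_left h5 hS0
  have hcont : ContinuousOn F (Set.Icc r (r + m)) := by
    have hvc : ContinuousOn v (Set.Icc r (r + m)) := by
      refine ContinuousOn.sub ?_ ?_
      · exact (continuous_single (A := fun _ : Fin n => ℝ) i).continuousOn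
      · exact (continuous_single (A := fun _ : Fin n => ℝ) j).comp_continuousOn
          (continuousOn_const.div continuousOn_id fun x hx => (hr0.trans_le hx.1).ne')
    have hq : Continuous fun u : Fin n → ℝ => (A⁻¹ *ᵥ u) ⬝ᵥ (A⁻¹ *ᵥ u) := by fun_prop
    exact hq.comp_continuousOn hvc
  obtain ⟨x, hx, hFx⟩ := intermediate_value_Icc (by linarith) hcont ⟨hlow, hhigh⟩
  have hx0 : 0 < x := hr0.trans_le hx.1
  exact ⟨x, τ / x, A⁻¹ *ᵥ v x, hx0.le, by positivity, by field_simp; linarith, hFx, hAv x⟩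

end Factorization

/-! ### Joining two ordered scale matrices by elementary moves. -/

section Chain

variable {n : ℕ} {ζ : Type*} [MeasurableSpace ζ]
  {π : Measure (EuclideanSpace ℝ (Fin n) × ζ)} {b : ζ → EuclideanSpace ℝ (Fin n)} {a : ζ → ℝ}
  {f : EuclideanSpace ℝ (Fin n) → ℝ}

/-- The mixture integral with scale matrix `S` is at most the one with scale matrix `S'`. -/
def MixtureLE (π : Measure (EuclideanSpace ℝ (Fin n) × ζ)) (b : ζ → EuclideanSpace ℝ (Fin n))
    (a : ζ → ℝ) (f : EuclideanSpace ℝ (Fin n) → ℝ) (S S' : Matrix (Fin n) (Fin n) ℝ) : Prop :=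
  ∀ A A' : Matrix (Fin n) (Fin n) ℝ, A * Aᵀ = S → A' * A'ᵀ = S' →
    mixtureIntegral π b a f A ≤ mixtureIntegral π b a f A'

/-- Positive definiteness of the middle matrix supplies the factor through which the two
inequalities are composed. -/
lemma MixtureLE.trans {S S' S'' : Matrix (Fin n) (Fin n) ℝ} (hS' : S'.PosDef)
    (h : MixtureLE π b a f S S') (h' : MixtureLE π b a f S' S'') : MixtureLE π b a f S S'' := by
  intro A A'' hA hA''
  obtain ⟨A', hA'⟩ := hS'.exists_mul_transpose
  exact (h A A' hA hA').trans (h' A' A'' hA' hA'')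

lemma IsRotationInvariant.mixtureLE_refl (hπ : IsRotationInvariant π)
    (hfm : Measurable f) (hb : Measurable b) (ha : Measurable a)
    {S : Matrix (Fin n) (Fin n) ℝ} (hS : S.PosDef) : MixtureLE π b a f S S :=
  fun _ _ hA hA' => (hπ.mixtureIntegral_congr hfm hb ha (hS.isUnit_det_of_mul_transpose hA)
    (hA.trans hA'.symm)).le

lemma IsRotationInvariant.mixtureLE_add_single (hπ : IsRotationInvariant π)
    (hfm : Measurable f) (hb : Measurable b) (ha : Measurable a) (hf : IsDirectionallyConvex f)
    (hint : ∀ A, Integrable (fun p : EuclideanSpace ℝ (Fin n) × ζ =>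
      f (b p.2 + a p.2 • euclideanMap A p.1)) π)
    {S : Matrix (Fin n) (Fin n) ℝ} (hS : S.PosDef) {c : ℝ}
    (hc : ∀ x : Fin n → ℝ, c * (x ⬝ᵥ x) ≤ x ⬝ᵥ (S *ᵥ x)) (i j : Fin n) {t : ℝ}
    (ht : 0 ≤ t) (htc : t ≤ c)
    (hS' : (S + t • (Matrix.single i j 1 + Matrix.single j i 1)).PosDef) :
    MixtureLE π b a f S (S + t • (Matrix.single i j 1 + Matrix.single j i 1)) := by
  rcases ht.eq_or_lt with rfl | ht
  · simpa using hπ.mixtureLE_refl hfm hb ha hS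
  intro A A' hA hA'
  have hdet := hS.isUnit_det_of_mul_transpose hA
  obtain ⟨x, y, w, hx, hy, hxy, hw, hAw⟩ := exists_unit_mulVec_eq hdet (hA ▸ hc) i j ht htc
  have hB := update_mul_transpose hw hAw
  rw [hxy, hA, ← hA'] at hB
  have hdet' := hS'.isUnit_det_of_mul_transpose hA'
  rw [hπ.mixtureIntegral_congr hfm hb ha hdet' hB.symm]
  exact hπ.mixtureIntegral_le_update hfm hb ha hf hint hw hx hy hAw

lemma dotProduct_single_add_single_mulVec (i j : Fin n) (x : Fin n → ℝ) :
    x ⬝ᵥ ((Matrix.single i j (1 : ℝ) + Matrix.single j i 1) *ᵥ x) = 2 * (x i * x j) := by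
  rw [Matrix.add_mulVec, dotProduct_add, Matrix.single_mulVec, Matrix.single_mulVec]
  simp [Function.update_apply, dotProduct]
  ring

lemma neg_dotProduct_le_two_mul (i j : Fin n) (x : Fin n → ℝ) :
    - (2 * (x ⬝ᵥ x)) ≤ 2 * (x i * x j) := by
  have h : ∀ k, x k ^ 2 ≤ x ⬝ᵥ x := fun k => by
    rw [sq]
    exact Finset.single_le_sum (f := fun k => x k * x k) (fun k _ => mul_self_nonneg _)
      (Finset.mem_univ k)
  nlinarith [h i, h j, sq_nonneg (x i + x j)]

/-- The entries are raised one pair at a time. The margin `2c` for `S` and the bound on `∑ t` keep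
every partial sum above `c` times the identity, so each single move remains admissible. -/
lemma IsRotationInvariant.mixtureLE_add_sum (hπ : IsRotationInvariant π)
    (hfm : Measurable f) (hb : Measurable b) (ha : Measurable a) (hf : IsDirectionallyConvex f)
    (hint : ∀ A, Integrable (fun p : EuclideanSpace ℝ (Fin n) × ζ =>
      f (b p.2 + a p.2 • euclideanMap A p.1)) π)
    {S : Matrix (Fin n) (Fin n) ℝ} (hS : Sᵀ = S) {c : ℝ} (hc0 : 0 < c)
    (hc : ∀ x : Fin n → ℝ, (2 * c) * (x ⬝ᵥ x) ≤ x ⬝ᵥ (S *ᵥ x))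
    {t : Fin n × Fin n → ℝ} (ht : ∀ p, 0 ≤ t p) (htc : 2 * ∑ p, t p ≤ c) :
    MixtureLE π b a f S
      (S + ∑ p, t p • (Matrix.single p.1 p.2 1 + Matrix.single p.2 p.1 1)) := by
  set T : Finset (Fin n × Fin n) → Matrix (Fin n) (Fin n) ℝ := fun P =>
    S + ∑ p ∈ P, t p • (Matrix.single p.1 p.2 1 + Matrix.single p.2 p.1 1) with hT
  have hsum : ∀ P : Finset (Fin n × Fin n), 2 * ∑ p ∈ P, t p ≤ c := fun P =>
    le_trans (by
      gcongr
      · exact fun p _ _ => ht p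
      · exact Finset.subset_univ P) htc
  have hTsymm : ∀ P, (T P)ᵀ = T P := fun P => by
    simp only [hT, Matrix.transpose_add, hS, Matrix.transpose_sum, Matrix.transpose_smul,
      Matrix.transpose_single]
    simp only [add_comm]
  have hTc : ∀ P, ∀ x : Fin n → ℝ, c * (x ⬝ᵥ x) ≤ x ⬝ᵥ (T P *ᵥ x) := fun P x => by
    have h1 : x ⬝ᵥ (T P *ᵥ x) = x ⬝ᵥ (S *ᵥ x) + ∑ p ∈ P, t p * (2 * (x p.1 * x p.2)) := by
      simp only [hT, Matrix.add_mulVec, dotProduct_add, Matrix.sum_mulVec, dotProduct_sum,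
        Matrix.smul_mulVec, dotProduct_smul, smul_eq_mul]
      simp only [← dotProduct_add, ← Matrix.add_mulVec, dotProduct_single_add_single_mulVec]
    have h2 : ∑ p ∈ P, t p * (-(2 * (x ⬝ᵥ x))) ≤ ∑ p ∈ P, t p * (2 * (x p.1 * x p.2)) :=
      Finset.sum_le_sum fun p _ =>
        mul_le_mul_of_nonneg_left (neg_dotProduct_le_two_mul _ _ _) (ht p)
    rw [← Finset.sum_mul] at h2
    have h3 : 0 ≤ x ⬝ᵥ x := by rw [dotProduct_self_eq_norm_sq]; positivity
    nlinarith [hc x, hsum P]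
  have hTpd : ∀ P, (T P).PosDef := fun P => posDef_of_forall_le hc0 (hTsymm P) (hTc P)
  have key : ∀ P, MixtureLE π b a f S (T P) := by
    intro P
    induction P using Finset.induction_on with
    | empty =>
      have : T ∅ = S := by simp [hT]
      have h := hTpd ∅
      rw [this] at h ⊢
      exact hπ.mixtureLE_refl hfm hb ha h
    | insert p P hp ih =>
      refine ih.trans (hTpd P) ?_
      have he : T (insert p P) =
          T P + t p • (Matrix.single p.1 p.2 1 + Matrix.single p.2 p.1 1) := by
        simp only [hT, Finset.sum_insert hp]
        abel
      have hpd := hTpd (insert p P)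
      rw [he] at hpd ⊢
      refine hπ.mixtureLE_add_single hfm hb ha hf hint (hTpd P) (hTc P) _ _ (ht p) ?_ hpd
      have := hsum {p}
      rw [Finset.sum_singleton] at this
      linarith [ht p]
  exact key Finset.univ

/-- Monotonicity of the mixture integral of a directionally convex function in the entries of the
scale matrix. -/
lemma IsRotationInvariant.mixtureLE_of_le (hπ : IsRotationInvariant π)
    (hfm : Measurable f) (hb : Measurable b) (ha : Measurable a) (hf : IsDirectionallyConvex f)
    (hint : ∀ A, Integrable (fun p : EuclideanSpace ℝ (Fin n) × ζ =>
      f (b p.2 + a p.2 • euclideanMap A p.1)) π)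
    {S S' : Matrix (Fin n) (Fin n) ℝ} (hS : S.PosDef) (hS' : S'.PosDef)
    (hle : ∀ i j, S i j ≤ S' i j) : MixtureLE π b a f S S' := by
  have hsymm : ∀ {M : Matrix (Fin n) (Fin n) ℝ}, M.PosDef → Mᵀ = M := fun h => by
    have := h.isHermitian
    rwa [Matrix.IsHermitian, Matrix.conjTranspose_eq_transpose_of_trivial] at this
  obtain ⟨c₁, hc₁, h₁⟩ := hS.exists_pos_forall_le
  obtain ⟨c₂, hc₂, h₂⟩ := hS'.exists_pos_forall_le
  -- Both endpoints, hence by convexity the whole segment, lie above `2c` times the identity; one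
  -- step size therefore serves everywhere.
  set c := min c₁ c₂ / 2 with hc
  have hc0 : 0 < c := by have := lt_min hc₁ hc₂; positivity
  have h1c : 2 * c ≤ c₁ := by rw [hc]; linarith [min_le_left c₁ c₂]
  have h2c : 2 * c ≤ c₂ := by rw [hc]; linarith [min_le_right c₁ c₂]
  set d : ℝ := ∑ p : Fin n × Fin n, (S' p.1 p.2 - S p.1 p.2) with hd
  obtain ⟨N, hN⟩ := exists_nat_gt (d / c)
  have hd0 : 0 ≤ d := Finset.sum_nonneg fun p _ => sub_nonneg.2 (hle _ _)
  have hN0 : 0 < (N : ℝ) := lt_of_le_of_lt (by positivity) hN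
  set L : ℝ → Matrix (Fin n) (Fin n) ℝ := fun s => S + s • (S' - S) with hL
  have hLsymm : ∀ s, (L s)ᵀ = L s := fun s => by simp [hL, hsymm hS, hsymm hS']
  have hLc : ∀ s, 0 ≤ s → s ≤ 1 → ∀ x : Fin n → ℝ,
      (2 * c) * (x ⬝ᵥ x) ≤ x ⬝ᵥ (L s *ᵥ x) := by
    intro s hs0 hs1 x
    have h0 : 0 ≤ x ⬝ᵥ x := by rw [dotProduct_self_eq_norm_sq]; positivity
    have he : x ⬝ᵥ (L s *ᵥ x) = (1 - s) * (x ⬝ᵥ (S *ᵥ x)) + s * (x ⬝ᵥ (S' *ᵥ x)) := by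
      simp only [hL, Matrix.add_mulVec, Matrix.smul_mulVec, Matrix.sub_mulVec, dotProduct_add,
        dotProduct_smul, dotProduct_sub, smul_eq_mul]
      ring
    rw [he]
    have e1 : (2 * c) * (x ⬝ᵥ x) ≤ x ⬝ᵥ (S *ᵥ x) :=
      (mul_le_mul_of_nonneg_right h1c h0).trans (h₁ x)
    have e2 : (2 * c) * (x ⬝ᵥ x) ≤ x ⬝ᵥ (S' *ᵥ x) :=
      (mul_le_mul_of_nonneg_right h2c h0).trans (h₂ x)
    have e3 := mul_le_mul_of_nonneg_left e1 (sub_nonneg.2 hs1)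
    have e4 := mul_le_mul_of_nonneg_left e2 hs0
    linarith
  have hLpd : ∀ s, 0 ≤ s → s ≤ 1 → (L s).PosDef := fun s hs0 hs1 =>
    posDef_of_forall_le (by linarith : 0 < 2 * c) (hLsymm s) (hLc s hs0 hs1)
  have key : ∀ k : ℕ, k ≤ N → MixtureLE π b a f S (L (k / N)) := by
    intro k
    induction k with
    | zero =>
      intro _
      have : L ((0 : ℕ) / N) = S := by simp [hL]
      rw [this]
      exact hπ.mixtureLE_refl hfm hb ha hS
    | succ k ih =>
      intro hk
      have hs0 : 0 ≤ (k : ℝ) / N := by positivity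
      have hs1 : (k : ℝ) / N ≤ 1 := by
        rw [div_le_one hN0]
        exact_mod_cast (Nat.le_succ k).trans hk
      refine (ih (Nat.le_of_succ_le hk)).trans (hLpd _ hs0 hs1) ?_
      have hstep := hπ.mixtureLE_add_sum hfm hb ha hf hint (hLsymm _) hc0 (hLc _ hs0 hs1)
        -- The sum runs over ordered pairs, so each symmetric increment is counted twice; hence `2 *
        -- N` for a step of length `1 / N`.
        (t := fun p => (S' p.1 p.2 - S p.1 p.2) / (2 * N))
        (fun p => div_nonneg (sub_nonneg.2 (hle _ _)) (by positivity)) (by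
          rw [← Finset.sum_div, ← hd]
          rw [div_lt_iff₀ hc0] at hN
          have : 2 * (d / (2 * N)) = d / N := by field_simp
          rw [this, div_le_iff₀ hN0]
          linarith)
      convert hstep using 1
      ext i j
      have h3 : ∀ M : Matrix (Fin n) (Fin n) ℝ,
          (∑ p : Fin n × Fin n, M p.1 p.2 •
            (Matrix.single p.1 p.2 (1 : ℝ) + Matrix.single p.2 p.1 1)) = M + Mᵀ := by
        intro M
        ext k l
        rw [Fintype.sum_prod_type]
        simp only [Matrix.sum_apply, Matrix.smul_apply, Matrix.add_apply, Matrix.single_apply,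
          smul_eq_mul, mul_add, Finset.sum_add_distrib, Matrix.transpose_apply]
        congr 1
        · simp [ite_and]
        · simp [ite_and]
      have h4 := h3 ((2 * (N : ℝ))⁻¹ • (S' - S))
      have h5 : (fun p : Fin n × Fin n => ((S' p.1 p.2 - S p.1 p.2) / (2 * N)) •
          (Matrix.single p.1 p.2 (1 : ℝ) + Matrix.single p.2 p.1 1)) =
        fun p => ((2 * (N : ℝ))⁻¹ • (S' - S)) p.1 p.2 •
          (Matrix.single p.1 p.2 (1 : ℝ) + Matrix.single p.2 p.1 1) := by
        ext1 p
        rw [Matrix.smul_apply, Matrix.sub_apply, smul_eq_mul, div_eq_inv_mul]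
      rw [h5, h4, Matrix.transpose_smul, Matrix.transpose_sub, hsymm hS, hsymm hS']
      simp only [hL, Matrix.add_apply, Matrix.smul_apply, Matrix.sub_apply, smul_eq_mul]
      push_cast
      field_simp
      ring
  have hfin := key N le_rfl
  rw [div_self hN0.ne'] at hfin
  simpa [hL] using hfin

end Chain

/-! ### Removing integrability by truncation. -/

section Truncation

variable {n : ℕ} {ζ : Type*} [MeasurableSpace ζ]
  {π : Measure (EuclideanSpace ℝ (Fin n) × ζ)} {b : ζ → EuclideanSpace ℝ (Fin n)} {a : ζ → ℝ}
  {f : EuclideanSpace ℝ (Fin n) → ℝ}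

lemma norm_euclideanMap_of_orthogonal {Q : Matrix (Fin n) (Fin n) ℝ} (hQ : Q * Qᵀ = 1)
    (u : EuclideanSpace ℝ (Fin n)) : ‖euclideanMap Q u‖ = ‖u‖ := by
  have h : ∀ v : EuclideanSpace ℝ (Fin n), ‖v‖ ^ 2 = v.ofLp ⬝ᵥ v.ofLp := fun v =>
    (dotProduct_self_eq_norm_sq v.ofLp).symm
  have h2 : ‖euclideanMap Q u‖ ^ 2 = ‖u‖ ^ 2 := by
    rw [h, h, Matrix.ofLp_toEuclideanCLM, Matrix.dotProduct_mulVec, ← Matrix.mulVec_transpose,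
      Matrix.mulVec_mulVec, mul_eq_one_comm.1 hQ, Matrix.one_mulVec]
  exact (sq_eq_sq₀ (norm_nonneg _) (norm_nonneg _)).1 h2

/-- Membership in `K` depends on `u` only through its norm, so rotations preserve `K`. -/
lemma IsRotationInvariant.restrict (hπ : IsRotationInvariant π)
    {K : Set (EuclideanSpace ℝ (Fin n) × ζ)} (hK : MeasurableSet K)
    (hinv : ∀ u u' z, ‖u‖ = ‖u'‖ → (u, z) ∈ K → (u', z) ∈ K) :
    IsRotationInvariant (π.restrict K) := by
  intro Q hQ
  have h := (hπ Q hQ).restrict_preimage hK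
  have he : (fun p : EuclideanSpace ℝ (Fin n) × ζ => (euclideanMap Q p.1, p.2)) ⁻¹' K = K := by
    ext ⟨u, z⟩
    exact ⟨hinv _ _ z (norm_euclideanMap_of_orthogonal hQ u),
      hinv _ _ z (norm_euclideanMap_of_orthogonal hQ u).symm⟩
  rwa [he] at h

/-- The region where the spherical part, the scale and the shift are all bounded by `r`. -/
def boundedRegion (b : ζ → EuclideanSpace ℝ (Fin n)) (a : ζ → ℝ) (r : ℝ) :
    Set (EuclideanSpace ℝ (Fin n) × ζ) :=
  {p | ‖p.1‖ ≤ r ∧ |a p.2| ≤ r ∧ ‖b p.2‖ ≤ r}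

lemma measurableSet_boundedRegion (hb : Measurable b) (ha : Measurable a) (r : ℝ) :
    MeasurableSet (boundedRegion b a r) := by
  have h1 : MeasurableSet {p : EuclideanSpace ℝ (Fin n) × ζ | ‖p.1‖ ≤ r} :=
    measurableSet_le (by fun_prop) (by fun_prop)
  have h2 : MeasurableSet {p : EuclideanSpace ℝ (Fin n) × ζ | |a p.2| ≤ r} :=
    measurableSet_le (by fun_prop) (by fun_prop)
  have h3 : MeasurableSet {p : EuclideanSpace ℝ (Fin n) × ζ | ‖b p.2‖ ≤ r} :=
    measurableSet_le (by fun_prop) (by fun_prop)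
  exact h1.inter (h2.inter h3)

omit [MeasurableSpace ζ] in
lemma boundedRegion_mono : Monotone fun k : ℕ => boundedRegion b a k := fun _ _ h _ hp =>
  ⟨hp.1.trans (Nat.cast_le.2 h), hp.2.1.trans (Nat.cast_le.2 h),
    hp.2.2.trans (Nat.cast_le.2 h)⟩

omit [MeasurableSpace ζ] in
lemma iUnion_boundedRegion : ⋃ k : ℕ, boundedRegion b a k = Set.univ := by
  refine Set.eq_univ_of_forall fun p => Set.mem_iUnion.2 ?_
  obtain ⟨k, hk⟩ := exists_nat_ge (max ‖p.1‖ (max |a p.2| ‖b p.2‖))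
  exact ⟨k, (le_max_left _ _).trans hk, ((le_max_left _ _).trans (le_max_right _ _)).trans hk,
    ((le_max_right _ _).trans (le_max_right _ _)).trans hk⟩

lemma tendsto_setLIntegral_boundedRegion (b : ζ → EuclideanSpace ℝ (Fin n)) (a : ζ → ℝ)
    (F : EuclideanSpace ℝ (Fin n) × ζ → ℝ≥0∞) :
    Filter.Tendsto (fun k : ℕ => ∫⁻ p in boundedRegion b a k, F p ∂π) Filter.atTop
      (nhds (∫⁻ p, F p ∂π)) := by
  have h := tendsto_atTop_iSup (f := fun k : ℕ => ∫⁻ p in boundedRegion b a k, F p ∂π)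
    fun _ _ hkl => lintegral_mono_set (boundedRegion_mono hkl)
  rwa [← setLIntegral_iUnion_of_directed F (directed_of_isDirected_le boundedRegion_mono),
    iUnion_boundedRegion, setLIntegral_univ] at h

lemma IsDirectionallyConvex.integrable_boundedRegion [IsFiniteMeasure π]
    (hf : IsDirectionallyConvex f) (hfm : Measurable f) (hb : Measurable b) (ha : Measurable a)
    (r : ℝ) (A : Matrix (Fin n) (Fin n) ℝ) :
    Integrable (fun p : EuclideanSpace ℝ (Fin n) × ζ => f (b p.2 + a p.2 • euclideanMap A p.1))
      (π.restrict (boundedRegion b a r)) := by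
  obtain ⟨M, hM⟩ := hf.exists_abs_le hfm (r + r * (‖euclideanMap A‖ * r))
  have hm : Measurable fun p : EuclideanSpace ℝ (Fin n) × ζ =>
      f (b p.2 + a p.2 • euclideanMap A p.1) := by fun_prop
  refine Integrable.of_bound (C := M) hm.aestronglyMeasurable ?_
  refine (ae_restrict_iff' (measurableSet_boundedRegion hb ha r)).2 (Filter.Eventually.of_forall ?_)
  rintro p ⟨h1, h2, h3⟩
  refine hM _ ((norm_add_le _ _).trans (add_le_add h3 ?_))
  rw [norm_smul, Real.norm_eq_abs]
  have h4 := (euclideanMap A).le_opNorm p.1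
  have hr : 0 ≤ r := (norm_nonneg _).trans h1
  gcongr
  exact h4.trans (by gcongr)

/-- Moving negative parts across gives an inequality in `[0, ∞]` that is stable under monotone
limits, where a difference could become `∞ - ∞`. -/
lemma lintegral_add_le_of_integral_le {X : Type*} [MeasurableSpace X] {m : Measure X}
    {F G : X → ℝ} (hF : Integrable F m) (hG : Integrable G m) (h : ∫ x, F x ∂m ≤ ∫ x, G x ∂m) :
    (∫⁻ x, ENNReal.ofReal (F x) ∂m) + ∫⁻ x, ENNReal.ofReal (-G x) ∂m ≤
      (∫⁻ x, ENNReal.ofReal (G x) ∂m) + ∫⁻ x, ENNReal.ofReal (-F x) ∂m := by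
  rw [integral_eq_lintegral_pos_part_sub_lintegral_neg_part hF,
    integral_eq_lintegral_pos_part_sub_lintegral_neg_part hG] at h
  have hfin : ∀ {F : X → ℝ}, Integrable F m → ∫⁻ x, ENNReal.ofReal (F x) ∂m ≠ ⊤ := fun hF =>
    (lt_of_le_of_lt (lintegral_ofReal_le_lintegral_enorm _) hF.2).ne
  have hfin' : ∀ {F : X → ℝ}, Integrable F m → ∫⁻ x, ENNReal.ofReal (-F x) ∂m ≠ ⊤ :=
    fun hF => hfin hF.neg
  rw [← ENNReal.toReal_le_toReal (ENNReal.add_ne_top.2 ⟨hfin hF, hfin' hG⟩)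
    (ENNReal.add_ne_top.2 ⟨hfin hG, hfin' hF⟩), ENNReal.toReal_add (hfin hF) (hfin' hG),
    ENNReal.toReal_add (hfin hG) (hfin' hF)]
  linarith

lemma IsRotationInvariant.lintegral_add_le [IsFiniteMeasure π] (hπ : IsRotationInvariant π)
    (hfm : Measurable f) (hb : Measurable b) (ha : Measurable a) (hf : IsDirectionallyConvex f)
    {S S' : Matrix (Fin n) (Fin n) ℝ} (hS : S.PosDef) (hS' : S'.PosDef)
    (hle : ∀ i j, S i j ≤ S' i j) {A A' : Matrix (Fin n) (Fin n) ℝ} (hA : A * Aᵀ = S)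
    (hA' : A' * A'ᵀ = S') :
    (∫⁻ p, ENNReal.ofReal (f (b p.2 + a p.2 • euclideanMap A p.1)) ∂π) +
        ∫⁻ p, ENNReal.ofReal (-f (b p.2 + a p.2 • euclideanMap A' p.1)) ∂π ≤
      (∫⁻ p, ENNReal.ofReal (f (b p.2 + a p.2 • euclideanMap A' p.1)) ∂π) +
        ∫⁻ p, ENNReal.ofReal (-f (b p.2 + a p.2 • euclideanMap A p.1)) ∂π := by
  refine le_of_tendsto_of_tendsto'
    ((tendsto_setLIntegral_boundedRegion b a _).add (tendsto_setLIntegral_boundedRegion b a _))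
    ((tendsto_setLIntegral_boundedRegion b a _).add (tendsto_setLIntegral_boundedRegion b a _))
    fun k => ?_
  have hint := fun A => hf.integrable_boundedRegion (π := π) hfm hb ha k A
  refine lintegral_add_le_of_integral_le (hint A) (hint A') ?_
  refine IsRotationInvariant.mixtureLE_of_le ?_ hfm hb ha hf hint hS hS' hle A A' hA hA'
  refine hπ.restrict (measurableSet_boundedRegion hb ha _) fun u u' z huu h => ?_
  exact ⟨huu ▸ h.1, h.2⟩

lemma EReal.coe_sub_le_coe_sub {p₁ n₁ p₂ n₂ : ℝ≥0∞} (h : p₁ + n₂ ≤ p₂ + n₁)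
    (h₁ : p₁ ≠ ⊤ ∨ n₁ ≠ ⊤) (h₂ : p₂ ≠ ⊤ ∨ n₂ ≠ ⊤) :
    (p₁ : EReal) - n₁ ≤ (p₂ : EReal) - n₂ := by
  induction n₁ with
  -- In `EReal`, subtracting `⊤` gives `⊥`, even from `⊤`.
  | top => simp
  | coe n₁ =>
    induction p₂ with
    | top =>
      have h2 : n₂ ≠ ⊤ := h₂.resolve_left (by simp)
      lift n₂ to NNReal using h2
      have : ((⊤ : ℝ≥0∞) : EReal) - ((n₂ : ℝ≥0∞) : EReal) = ⊤ := rfl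
      rw [this]
      exact le_top
    | coe p₂ =>
      have hlt : p₁ + n₂ ≠ ⊤ := ne_top_of_le_ne_top (by simp) h
      obtain ⟨h3, h4⟩ := ENNReal.add_ne_top.1 hlt
      lift p₁ to NNReal using h3
      lift n₂ to NNReal using h4
      have h5 : (p₁ : ℝ) + n₂ ≤ p₂ + n₁ := by exact_mod_cast h
      have h6 : ((p₁ : ℝ) - n₁ : ℝ) ≤ (p₂ : ℝ) - n₂ := by linarith
      simp only [EReal.coe_nnreal_eq_coe_real]
      exact_mod_cast h6

end Truncation

/-! ### The spherical law and its linear images. -/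

section SphericalLaw

variable {n : ℕ} {g : ℝ → ℝ}

/-- The spherical law on `ℝⁿ` with density generator `g`. -/
noncomputable def sphericalLaw (n : ℕ) (g : ℝ → ℝ) : Measure (EuclideanSpace ℝ (Fin n)) :=
  volume.withDensity fun u => ENNReal.ofReal (normConst n g * g (quadForm 1 u))

lemma measurable_quadForm (S : Matrix (Fin n) (Fin n) ℝ) : Measurable (quadForm S) := by
  unfold quadForm
  have : Continuous fun x : EuclideanSpace ℝ (Fin n) => x.ofLp ⬝ᵥ (S *ᵥ x.ofLp) := by fun_prop
  exact this.measurable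

lemma map_withDensity_comp {X Y : Type*} [MeasurableSpace X] [MeasurableSpace Y] (m : Measure X)
    {T : X → Y} (hT : Measurable T) {h : Y → ℝ≥0∞} (hh : Measurable h) :
    (m.withDensity fun x => h (T x)).map T = (m.map T).withDensity h := by
  ext s hs
  rw [Measure.map_apply hT hs, withDensity_apply _ (hT hs), withDensity_apply _ hs,
    setLIntegral_map hs hh hT]

lemma map_euclideanMap_volume {A : Matrix (Fin n) (Fin n) ℝ} (hA : IsUnit A.det) :
    (volume : Measure (EuclideanSpace ℝ (Fin n))).map (euclideanMap A) =
      ENNReal.ofReal |A.det|⁻¹ • volume := by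
  have hdet : LinearMap.det (euclideanMap A : EuclideanSpace ℝ (Fin n) →ₗ[ℝ] _) = A.det := by
    rw [Matrix.coe_toEuclideanCLM_eq_toEuclideanLin, Matrix.toEuclideanLin, Matrix.toLpLin_eq_toLin,
      LinearMap.det_toLin]
  have := Measure.map_linearMap_addHaar_eq_smul_addHaar
    (volume : Measure (EuclideanSpace ℝ (Fin n)))
    (f := (euclideanMap A : EuclideanSpace ℝ (Fin n) →ₗ[ℝ] _)) (by rw [hdet]; exact hA.ne_zero)
  rw [hdet, abs_inv] at this
  exact this

lemma quadForm_inv_euclideanMap {A : Matrix (Fin n) (Fin n) ℝ} (hA : IsUnit A.det)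
    (u : EuclideanSpace ℝ (Fin n)) : quadForm (A * Aᵀ)⁻¹ (euclideanMap A u) = quadForm 1 u := by
  have hAt : IsUnit Aᵀ.det := by rwa [Matrix.det_transpose]
  rw [quadForm, quadForm, Matrix.ofLp_toEuclideanCLM, Matrix.mulVec_mulVec, Matrix.mul_inv_rev,
    Matrix.mul_assoc, Matrix.nonsing_inv_mul _ hA, Matrix.mul_one, Matrix.dotProduct_mulVec,
    ← Matrix.mulVec_transpose, Matrix.mulVec_mulVec, Matrix.transpose_nonsing_inv,
    Matrix.transpose_transpose, Matrix.nonsing_inv_mul _ hA, Matrix.one_mulVec]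

lemma map_sphericalLaw (hg : Measurable g) {A : Matrix (Fin n) (Fin n) ℝ} (hA : IsUnit A.det) :
    (sphericalLaw n g).map (euclideanMap A) = volume.withDensity fun x =>
      ENNReal.ofReal (normConst n g / |A.det| * g (quadForm (A * Aᵀ)⁻¹ x)) := by
  set h : EuclideanSpace ℝ (Fin n) → ℝ≥0∞ := fun x =>
    ENNReal.ofReal (normConst n g * g (quadForm (A * Aᵀ)⁻¹ x)) with hh
  have hhm : Measurable h :=
    ((hg.comp (measurable_quadForm _)).const_mul _).ennreal_ofReal
  have h1 : sphericalLaw n g = volume.withDensity fun u => h (euclideanMap A u) := by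
    simp only [sphericalLaw, hh, quadForm_inv_euclideanMap hA]
  rw [h1, map_withDensity_comp _ (by fun_prop) hhm, map_euclideanMap_volume hA,
    withDensity_smul_measure, ← withDensity_smul _ hhm]
  congr 1
  ext x
  rw [Pi.smul_apply, smul_eq_mul, hh, ← ENNReal.ofReal_mul (by positivity)]
  congr 1
  ring

/-- This is the change of variables `map_sphericalLaw` with `Q Qᵀ = 1` and `|det Q| = 1`. -/
lemma measurePreserving_sphericalLaw (hg : Measurable g) {Q : Matrix (Fin n) (Fin n) ℝ}
    (hQ : Q * Qᵀ = 1) :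
    MeasurePreserving (euclideanMap Q) (sphericalLaw n g) (sphericalLaw n g) := by
  have hd : Q.det * Q.det = 1 := by
    have := congrArg Matrix.det hQ
    rwa [Matrix.det_mul, Matrix.det_transpose, Matrix.det_one] at this
  have hu : IsUnit Q.det := IsUnit.of_mul_eq_one _ hd
  have habs : |Q.det| = 1 := by
    rcases mul_self_eq_one_iff.1 hd with h | h <;> simp [h]
  refine ⟨by fun_prop, ?_⟩
  rw [map_sphericalLaw hg hu, hQ, habs, inv_one, div_one]
  rfl

instance : SFinite (sphericalLaw n g) := by unfold sphericalLaw; infer_instance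

lemma isRotationInvariant_sphericalLaw_prod {ζ : Type*} [MeasurableSpace ζ] (H : Measure ζ)
    [SFinite H] (hg : Measurable g) : IsRotationInvariant ((sphericalLaw n g).prod H) :=
  fun _ hQ => (measurePreserving_sphericalLaw hg hQ).prod (MeasurePreserving.id H)

lemma HasDensityGenerator.map_sphericalLaw_eq {Q : Measure (EuclideanSpace ℝ (Fin n))}
    {S : Matrix (Fin n) (Fin n) ℝ} (hQ : HasDensityGenerator Q 0 S g) (hS : S.PosDef)
    {A : Matrix (Fin n) (Fin n) ℝ} (hA : A * Aᵀ = S) :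
    (sphericalLaw n g).map (euclideanMap A) = Q := by
  rw [map_sphericalLaw hQ.isDensityGenerator.measurable (hS.isUnit_det_of_mul_transpose hA),
    hQ.law_eq, hA]
  have : Real.sqrt |S.det| = |A.det| := by
    rw [← hA, Matrix.det_mul, Matrix.det_transpose, abs_mul_self, Real.sqrt_mul_self_eq_abs]
  simp only [this, sub_zero]

end SphericalLaw

/-! ### Representing `Y` over the spherical law and `H`. -/

section LSE

variable {Ω : Type*} [MeasurableSpace Ω] {n q : ℕ} {Y : Ω → EuclideanSpace ℝ (Fin n)}
  {P : Measure Ω} {μ δ : EuclideanSpace ℝ (Fin n)} {S : Matrix (Fin n) (Fin n) ℝ} {g : ℝ → ℝ}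
  {α β : EuclideanSpace ℝ (Fin q) → ℝ} {H : Measure (EuclideanSpace ℝ (Fin q))}

lemma IsLSE.measurable_generator (hY : IsLSE Y P μ S δ g α β H) : Measurable g := by
  obtain ⟨_, _, _, _, _, _, _, _, _, _, hg, _⟩ := hY
  exact hg.isDensityGenerator.measurable

/-- Total mass one is inherited from the law of `X`, a linear image of the spherical law, so the
normalizing constant need not be computed in polar coordinates. -/
lemma IsLSE.isProbabilityMeasure_sphericalLaw (hY : IsLSE Y P μ S δ g α β H) :
    IsProbabilityMeasure (sphericalLaw n g) := by
  obtain ⟨hS, _, _, P', X, Z, Q, ψ, hP', -, hg, hX, -⟩ := hY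
  obtain ⟨A, hA⟩ := hS.exists_mul_transpose
  have hQ : IsProbabilityMeasure Q := hX.isProbabilityMeasure_iff.1 hP'
  rw [← hg.map_sphericalLaw_eq hS hA] at hQ
  exact (Measure.isProbabilityMeasure_map_iff (by fun_prop)).1 hQ

/-- The standard representation of a location-scale mixture: `Y ∼ μ + β(z) δ + α(z) A u` with
`u` spherical and `A Aᵀ = S`. -/
lemma IsLSE.identDistrib (hY : IsLSE Y P μ S δ g α β H) (hα : Measurable α) (hβ : Measurable β)
    [IsProbabilityMeasure H] {A : Matrix (Fin n) (Fin n) ℝ} (hA : A * Aᵀ = S) :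
    IdentDistrib Y (fun p : EuclideanSpace ℝ (Fin n) × EuclideanSpace ℝ (Fin q) =>
      (μ + β p.2 • δ) + α p.2 • euclideanMap A p.1) P ((sphericalLaw n g).prod H) := by
  have hν := hY.isProbabilityMeasure_sphericalLaw
  obtain ⟨hS, _, _, P', X, Z, Q, ψ, hP', -, hg, hX, hZ, hXZ, hYd⟩ := hY
  refine hYd.trans ?_
  have hpair : IdentDistrib (fun ω => (X ω, Z ω))
      (fun p : EuclideanSpace ℝ (Fin n) × EuclideanSpace ℝ (Fin q) => (euclideanMap A p.1, p.2))
      P' ((sphericalLaw n g).prod H) := by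
    refine ⟨hX.aemeasurable.prodMk hZ.aemeasurable, by fun_prop, ?_⟩
    rw [(indepFun_iff_map_prod_eq_prod_map_map hX.aemeasurable hZ.aemeasurable).1 hXZ,
      hX.map_eq, hZ.map_eq, ← hg.map_sphericalLaw_eq hS hA]
    have := Measure.map_prod_map (sphericalLaw n g) H
      (euclideanMap A).continuous.measurable measurable_id
    rw [Measure.map_id] at this
    exact this
  have := hpair.comp (u := fun p : EuclideanSpace ℝ (Fin n) × EuclideanSpace ℝ (Fin q) =>
    (μ + β p.2 • δ) + α p.2 • p.1) (by fun_prop)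
  refine IdentDistrib.trans (IdentDistrib.of_ae_eq ?_ ?_) this
  · exact hYd.aemeasurable_snd
  · refine Filter.Eventually.of_forall fun ω => ?_
    simp only [Function.comp_apply]
    abel

end LSE

/-! ### First and second moments of rotation-invariant mixtures. -/

section Moments

variable {n : ℕ} {ζ : Type*} [MeasurableSpace ζ]
  {π : Measure (EuclideanSpace ℝ (Fin n) × ζ)} {b : ζ → EuclideanSpace ℝ (Fin n)} {a : ζ → ℝ}

lemma MeasureTheory.MeasurePreserving.integral_comp_of_measurable {X : Type*} [MeasurableSpace X]
    {m : Measure X} {T : X → X} (hT : MeasurePreserving T m m) {F : X → ℝ} (hF : Measurable F) :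
    ∫ x, F (T x) ∂m = ∫ x, F x ∂m := by
  conv_rhs => rw [← hT.map_eq, integral_map hT.aemeasurable hF.aestronglyMeasurable]

lemma IsRotationInvariant.measurePreserving_neg (hπ : IsRotationInvariant π) :
    MeasurePreserving (fun p : EuclideanSpace ℝ (Fin n) × ζ => (-p.1, p.2)) π π := by
  have h := hπ (-1) (by simp)
  simpa [euclideanMap] using h

/-- The reflection `u ↦ -u` preserves `π`; half the sum and half the difference of the vector and
its reflection isolate `b` and `a A u`, and `A⁻¹` recovers `a u`. -/
lemma IsRotationInvariant.memLp_of_memLp_add (hπ : IsRotationInvariant π)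
    {A : Matrix (Fin n) (Fin n) ℝ} (hA : IsUnit A.det)
    (h : MemLp (fun p : EuclideanSpace ℝ (Fin n) × ζ => b p.2 + a p.2 • euclideanMap A p.1) 2 π) :
    MemLp (fun p : EuclideanSpace ℝ (Fin n) × ζ => b p.2) 2 π ∧
      MemLp (fun p : EuclideanSpace ℝ (Fin n) × ζ => a p.2 • p.1) 2 π := by
  have h' := h.comp_measurePreserving hπ.measurePreserving_neg
  have hb := (h.add h').const_smul (2⁻¹ : ℝ)
  have ha := (euclideanMap A⁻¹).comp_memLp' ((h.sub h').const_smul (2⁻¹ : ℝ))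
  constructor
  · refine hb.ae_eq (Filter.Eventually.of_forall fun p => ?_)
    simp only [Pi.smul_apply, Pi.add_apply, Function.comp_apply, map_neg]
    module
  · refine ha.ae_eq (Filter.Eventually.of_forall fun p => ?_)
    simp only [Pi.smul_apply, Pi.sub_apply, Function.comp_apply, map_neg]
    have e : (2⁻¹ : ℝ) • (b p.2 + a p.2 • euclideanMap A p.1 -
        (b p.2 + a p.2 • -euclideanMap A p.1)) = a p.2 • euclideanMap A p.1 := by module
    rw [e, map_smul, ← ContinuousLinearMap.comp_apply, ← ContinuousLinearMap.mul_def, ← map_mul,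
      Matrix.nonsing_inv_mul _ hA, map_one, one_apply_eq_self]

lemma memLp_apply {X : Type*} [MeasurableSpace X] {m : Measure X}
    {F : X → EuclideanSpace ℝ (Fin n)} {r : ℝ≥0∞} (hF : MemLp F r m) (i : Fin n) :
    MemLp (fun x => F x i) r m :=
  (EuclideanSpace.proj i : EuclideanSpace ℝ (Fin n) →L[ℝ] ℝ).comp_memLp' hF

/-- The entries of the second moment matrix of `a(z) u`. -/
noncomputable def secondMoment (π : Measure (EuclideanSpace ℝ (Fin n) × ζ)) (a : ζ → ℝ)
    (k l : Fin n) : ℝ :=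
  ∫ p, (a p.2 • p.1) k * (a p.2 • p.1) l ∂π

/-- Flipping the sign of coordinate `k` alone negates the integrand. -/
lemma IsRotationInvariant.secondMoment_of_ne (hπ : IsRotationInvariant π) (ha : Measurable a)
    {k l : Fin n} (hkl : k ≠ l) : secondMoment π a k l = 0 := by
  set Q : Matrix (Fin n) (Fin n) ℝ := Matrix.diagonal (Function.update 1 k (-1)) with hQ
  have hQQ : Q * Qᵀ = 1 := by
    rw [hQ, Matrix.diagonal_transpose, Matrix.diagonal_mul_diagonal, ← Matrix.diagonal_one]
    congr 1
    ext i
    by_cases h : i = k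
    · subst h; simp
    · simp [h]
  have h := (hπ Q hQQ).integral_comp_of_measurable
    (F := fun p => (a p.2 • p.1) k * (a p.2 • p.1) l) (by fun_prop)
  have h2 : ∀ p : EuclideanSpace ℝ (Fin n) × ζ,
      (a p.2 • euclideanMap Q p.1) k * (a p.2 • euclideanMap Q p.1) l =
        -((a p.2 • p.1) k * (a p.2 • p.1) l) := fun p => by
    simp [hQ, Matrix.mulVec_diagonal, Function.update_of_ne hkl.symm]
  simp only [h2, integral_neg] at h
  rw [secondMoment]
  linarith

lemma IsRotationInvariant.secondMoment_self (hπ : IsRotationInvariant π) (ha : Measurable a)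
    (k l : Fin n) : secondMoment π a k k = secondMoment π a l l := by
  set Q : Matrix (Fin n) (Fin n) ℝ := (Equiv.swap k l).permMatrix ℝ with hQ
  have hQQ : Q * Qᵀ = 1 := by
    rw [hQ, Matrix.transpose_permMatrix, ← Matrix.permMatrix_mul, inv_mul_cancel,
      Matrix.permMatrix_one]
  have h := (hπ Q hQQ).integral_comp_of_measurable
    (F := fun p => (a p.2 • p.1) l * (a p.2 • p.1) l) (by fun_prop)
  rw [secondMoment, secondMoment, ← h]
  simp [hQ, Matrix.permMatrix_mulVec]

lemma integral_euclideanMap_mul (hπ : IsRotationInvariant π) (ha : Measurable a)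
    (hU : MemLp (fun p : EuclideanSpace ℝ (Fin n) × ζ => a p.2 • p.1) 2 π)
    (A : Matrix (Fin n) (Fin n) ℝ) (k i j : Fin n) :
    ∫ p, (a p.2 • euclideanMap A p.1) i * (a p.2 • euclideanMap A p.1) j ∂π =
      secondMoment π a k k * (A * Aᵀ) i j := by
  have hint : ∀ k l, Integrable (fun p : EuclideanSpace ℝ (Fin n) × ζ =>
      (a p.2 • p.1) k * (a p.2 • p.1) l) π := fun k l =>
    (memLp_apply hU k).integrable_mul (memLp_apply hU l)
  have e : ∀ p : EuclideanSpace ℝ (Fin n) × ζ,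
      (a p.2 • euclideanMap A p.1) i * (a p.2 • euclideanMap A p.1) j =
        ∑ k, ∑ l, (A i k * A j l) * ((a p.2 • p.1) k * (a p.2 • p.1) l) := fun p => by
    rw [← map_smul, Matrix.ofLp_toEuclideanCLM, Matrix.mulVec, Matrix.mulVec, dotProduct,
      dotProduct, Finset.sum_mul_sum]
    refine Finset.sum_congr rfl fun k _ => Finset.sum_congr rfl fun l _ => ?_
    ring
  simp only [e]
  rw [integral_finsetSum _ fun k _ => integrable_finsetSum _ fun l _ => (hint k l).const_mul _]
  simp only [integral_finsetSum _ fun l _ => (hint _ l).const_mul _, integral_const_mul]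
  rw [Matrix.mul_apply, Finset.mul_sum]
  refine Finset.sum_congr rfl fun m _ => ?_
  rw [Finset.sum_eq_single m]
  · rw [Matrix.transpose_apply, ← hπ.secondMoment_self ha m k, secondMoment]
    ring
  · intro l _ hl
    have := hπ.secondMoment_of_ne ha hl.symm
    rw [secondMoment] at this
    rw [this, mul_zero]
  · simp

lemma integral_odd_eq_zero (hπ : IsRotationInvariant π)
    {F : EuclideanSpace ℝ (Fin n) × ζ → ℝ} (hF : Measurable F)
    (hodd : ∀ u z, F (-u, z) = -F (u, z)) : ∫ p, F p ∂π = 0 := by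
  have h := hπ.measurePreserving_neg.integral_comp_of_measurable hF
  simp only [hodd, integral_neg] at h
  linarith

lemma IsRotationInvariant.integral_apply [IsFiniteMeasure π] (hπ : IsRotationInvariant π)
    (ha : Measurable a) {A : Matrix (Fin n) (Fin n) ℝ} (hA : IsUnit A.det)
    (h : MemLp (fun p : EuclideanSpace ℝ (Fin n) × ζ => b p.2 + a p.2 • euclideanMap A p.1) 2 π)
    (i : Fin n) :
    ∫ p, (b p.2 + a p.2 • euclideanMap A p.1) i ∂π = ∫ p, b p.2 i ∂π := by
  obtain ⟨hV, hU⟩ := hπ.memLp_of_memLp_add hA h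
  have hW : MemLp (fun p : EuclideanSpace ℝ (Fin n) × ζ => a p.2 • euclideanMap A p.1) 2 π := by
    simpa only [Function.comp_def, map_smul] using (euclideanMap A).comp_memLp' hU
  simp only [PiLp.add_apply]
  rw [integral_add ((memLp_apply hV i).integrable (by norm_num))
    ((memLp_apply hW i).integrable (by norm_num)),
    integral_odd_eq_zero hπ (F := fun p => (a p.2 • euclideanMap A p.1) i) (by fun_prop)
      (fun u z => by simp), add_zero]

/-- The cross terms are odd in `u` and integrate to zero; the index `k` is arbitrary because all
diagonal second moments coincide. -/
lemma IsRotationInvariant.integral_apply_mul [IsFiniteMeasure π] (hπ : IsRotationInvariant π)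
    (hb : Measurable b) (ha : Measurable a) {A : Matrix (Fin n) (Fin n) ℝ} (hA : IsUnit A.det)
    (h : MemLp (fun p : EuclideanSpace ℝ (Fin n) × ζ => b p.2 + a p.2 • euclideanMap A p.1) 2 π)
    (k i j : Fin n) :
    ∫ p, (b p.2 + a p.2 • euclideanMap A p.1) i * (b p.2 + a p.2 • euclideanMap A p.1) j ∂π =
      (∫ p, b p.2 i * b p.2 j ∂π) + secondMoment π a k k * (A * Aᵀ) i j := by
  obtain ⟨hV, hU⟩ := hπ.memLp_of_memLp_add hA h
  have hW : MemLp (fun p : EuclideanSpace ℝ (Fin n) × ζ => a p.2 • euclideanMap A p.1) 2 π := by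
    simpa only [Function.comp_def, map_smul] using (euclideanMap A).comp_memLp' hU
  have e : ∀ p : EuclideanSpace ℝ (Fin n) × ζ,
      (b p.2 + a p.2 • euclideanMap A p.1) i * (b p.2 + a p.2 • euclideanMap A p.1) j =
        (b p.2 i * b p.2 j + (a p.2 • euclideanMap A p.1) i * (a p.2 • euclideanMap A p.1) j) +
        (b p.2 i * (a p.2 • euclideanMap A p.1) j +
          (a p.2 • euclideanMap A p.1) i * b p.2 j) := fun p => by
    simp only [PiLp.add_apply]
    ring
  have i1 : Integrable (fun p => b p.2 i * b p.2 j) π :=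
    (memLp_apply hV i).integrable_mul (memLp_apply hV j)
  have i2 : Integrable (fun p => (a p.2 • euclideanMap A p.1) i *
      (a p.2 • euclideanMap A p.1) j) π := (memLp_apply hW i).integrable_mul (memLp_apply hW j)
  have i3 : Integrable (fun p => b p.2 i * (a p.2 • euclideanMap A p.1) j) π :=
    (memLp_apply hV i).integrable_mul (memLp_apply hW j)
  have i4 : Integrable (fun p => (a p.2 • euclideanMap A p.1) i * b p.2 j) π :=
    (memLp_apply hW i).integrable_mul (memLp_apply hV j)
  simp only [e]
  rw [integral_add (Integrable.fun_add i1 i2) (Integrable.fun_add i3 i4), integral_add i1 i2,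
    integral_euclideanMap_mul hπ ha hU A k i j,
    integral_odd_eq_zero hπ (F := fun p => b p.2 i * (a p.2 • euclideanMap A p.1) j +
          (a p.2 • euclideanMap A p.1) i * b p.2 j) (by fun_prop)
      (fun u z => by simp; ring), add_zero]

end Moments

/-! ### Nondegeneracy of the scale and shift factors. -/

section Positivity

variable {n : ℕ} {ζ : Type*} [MeasurableSpace ζ] {H : Measure ζ} [IsProbabilityMeasure H]
  {g : ℝ → ℝ} {a : ζ → ℝ}

/-- If one diagonal moment vanishes, all do, so `a(z) u = 0` almost everywhere. The spherical law
has a density and does not charge the origin, so Fubini yields a `u ≠ 0` for which `a = 0` holds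
`H`-almost surely. -/
lemma secondMoment_pos (hg : Measurable g) [IsProbabilityMeasure (sphericalLaw n g)]
    (ha : Measurable a)
    (hU : MemLp (fun p : EuclideanSpace ℝ (Fin n) × ζ => a p.2 • p.1) 2
      ((sphericalLaw n g).prod H)) (ha0 : ¬ ∀ᵐ z ∂H, a z = 0) (k : Fin n) :
    0 < secondMoment ((sphericalLaw n g).prod H) a k k := by
  set π := (sphericalLaw n g).prod H with hπdef
  have hπ : IsRotationInvariant π := isRotationInvariant_sphericalLaw_prod H hg
  have hnn : 0 ≤ secondMoment π a k k := integral_nonneg fun p => mul_self_nonneg _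
  refine hnn.lt_of_ne fun h0 => ha0 ?_
  have hcoord : ∀ l, ∀ᵐ p ∂π, (a p.2 • p.1) l = 0 := fun l => by
    have h1 : secondMoment π a l l = 0 := by rw [hπ.secondMoment_self ha l k, ← h0]
    rw [secondMoment, integral_eq_zero_iff_of_nonneg (fun p => mul_self_nonneg _)
      ((memLp_apply hU l).integrable_mul (memLp_apply hU l))] at h1
    filter_upwards [h1] with p hp
    exact mul_self_eq_zero.1 hp
  have hall : ∀ᵐ p ∂π, a p.2 • p.1 = 0 := by
    filter_upwards [ae_all_iff.2 hcoord] with p hp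
    ext l
    exact hp l
  have hnz : ∀ᵐ u ∂(sphericalLaw n g), u ≠ 0 := by
    have hvol : (volume : Measure (EuclideanSpace ℝ (Fin n))) {0} = 0 := by
      have : Nonempty (Fin n) := ⟨k⟩
      exact measure_singleton 0
    have hac : sphericalLaw n g ≪ volume := withDensity_absolutelyContinuous _ _
    exact measure_eq_zero_iff_ae_notMem.1 (hac hvol)
  have hswap := Measure.ae_ae_of_ae_prod hall
  obtain ⟨u, hu, hu0⟩ := (hswap.and hnz).exists
  filter_upwards [hu] with z hz
  exact (smul_eq_zero.1 hz).resolve_right hu0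

/-- Finite second moments of `Y` do not make `β(Z)` integrable when `δ = 0`. If `w` is not
integrable, integrability of the products forces `c = d = 0`; otherwise the positive number `∫ w`
cancels. -/
lemma eq_of_integral_mul_eq {X : Type*} [MeasurableSpace X] {m : Measure X} {w : X → ℝ}
    (hw : 0 ≤ w) (hw0 : ¬ w =ᵐ[m] 0) {c d : ℝ} (hc : Integrable (fun x => w x * c) m)
    (hd : Integrable (fun x => w x * d) m) (h : ∫ x, w x * c ∂m = ∫ x, w x * d ∂m) : c = d := by
  by_cases hi : Integrable w m
  · rw [integral_mul_const, integral_mul_const] at h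
    refine mul_left_cancel₀ (fun h0 => hw0 ?_) h
    exact (integral_eq_zero_iff_of_nonneg hw hi).1 h0
  · have : ∀ {c : ℝ}, Integrable (fun x => w x * c) m → c = 0 := fun {c} hc => by
      by_contra hc0
      have := hc.mul_const c⁻¹
      simp only [mul_assoc, mul_inv_cancel₀ hc0, mul_one] at this
      exact hi this
    rw [this hc, this hd]

end Positivity

/-! ### Consequences of the order for means and mixed moments. -/

section Dcx

variable {Ω₁ Ω₂ : Type*} [MeasurableSpace Ω₁] [MeasurableSpace Ω₂] {n : ℕ}
  {Y₁ : Ω₁ → EuclideanSpace ℝ (Fin n)} {P₁ : Measure Ω₁}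
  {Y₂ : Ω₂ → EuclideanSpace ℝ (Fin n)} {P₂ : Measure Ω₂}

lemma extExpectation_eq_integral {h : Ω₁ → ℝ} (hh : Integrable h P₁) :
    HasExpectation h P₁ ∧ extExpectation h P₁ = ((∫ ω, h ω ∂P₁ : ℝ) : EReal) := by
  have hfin : ∀ {F : Ω₁ → ℝ}, Integrable F P₁ → ∫⁻ x, ENNReal.ofReal (F x) ∂P₁ ≠ ⊤ := fun hF =>
    (lt_of_le_of_lt (lintegral_ofReal_le_lintegral_enorm _) hF.2).ne
  have h1 := hfin hh
  have h2 : ∫⁻ x, ENNReal.ofReal (-h x) ∂P₁ ≠ ⊤ := hfin hh.neg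
  refine ⟨Or.inl h1, ?_⟩
  rw [extExpectation, integral_eq_lintegral_pos_part_sub_lintegral_neg_part hh, EReal.coe_sub,
    EReal.coe_ennreal_toReal h1, EReal.coe_ennreal_toReal h2]

lemma DcxLE.integral_le (h : DcxLE Y₁ P₁ Y₂ P₂) {f : EuclideanSpace ℝ (Fin n) → ℝ}
    (hfm : Measurable f) (hf : IsDirectionallyConvex f) (h₁ : Integrable (fun ω => f (Y₁ ω)) P₁)
    (h₂ : Integrable (fun ω => f (Y₂ ω)) P₂) :
    ∫ ω, f (Y₁ ω) ∂P₁ ≤ ∫ ω, f (Y₂ ω) ∂P₂ := by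
  obtain ⟨a₁, e₁⟩ := extExpectation_eq_integral h₁
  obtain ⟨a₂, e₂⟩ := extExpectation_eq_integral h₂
  have := h f hfm hf a₁ a₂
  rw [e₁, e₂] at this
  exact EReal.coe_le_coe_iff.1 this

lemma isDirectionallyConvex_mul_apply (c : ℝ) (i : Fin n) :
    IsDirectionallyConvex fun x : EuclideanSpace ℝ (Fin n) => c * x i := by
  intro k l ε₁ ε₂ _ _ x
  simp only [diffOp, PiLp.add_apply]
  exact le_of_eq (by ring)

lemma isDirectionallyConvex_apply_mul_apply (i j : Fin n) :
    IsDirectionallyConvex fun x : EuclideanSpace ℝ (Fin n) => x i * x j := by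
  intro k l ε₁ ε₂ h₁ h₂ x
  have hs : ∀ (k i : Fin n) {ε : ℝ}, 0 ≤ ε → 0 ≤ (EuclideanSpace.single k ε) i := by
    intro k i ε hε
    rw [PiLp.single_apply]
    split_ifs
    · exact hε
    · exact le_rfl
  have e1 := mul_nonneg (hs k i h₁) (hs l j h₂)
  have e2 := mul_nonneg (hs l i h₂) (hs k j h₁)
  simp only [diffOp, PiLp.add_apply]
  nlinarith

/-- Both `xᵢ` and `-xᵢ` are directionally convex. -/
lemma DcxLE.integral_apply_eq [IsFiniteMeasure P₁] [IsFiniteMeasure P₂]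
    (h : DcxLE Y₁ P₁ Y₂ P₂) (h₁ : MemLp Y₁ 2 P₁) (h₂ : MemLp Y₂ 2 P₂) (i : Fin n) :
    ∫ ω, Y₁ ω i ∂P₁ = ∫ ω, Y₂ ω i ∂P₂ := by
  have i₁ := (memLp_apply h₁ i).integrable (by norm_num)
  have i₂ := (memLp_apply h₂ i).integrable (by norm_num)
  have key := fun c : ℝ => h.integral_le (by fun_prop) (isDirectionallyConvex_mul_apply c i)
    (i₁.const_mul c) (i₂.const_mul c)
  have k1 := key 1
  have k2 := key (-1)
  simp only [integral_const_mul] at k1 k2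
  linarith

lemma DcxLE.integral_apply_mul_le (h : DcxLE Y₁ P₁ Y₂ P₂) (h₁ : MemLp Y₁ 2 P₁)
    (h₂ : MemLp Y₂ 2 P₂) (i j : Fin n) :
    ∫ ω, Y₁ ω i * Y₁ ω j ∂P₁ ≤ ∫ ω, Y₂ ω i * Y₂ ω j ∂P₂ :=
  h.integral_le (by fun_prop) (isDirectionallyConvex_apply_mul_apply i j)
    ((memLp_apply h₁ i).integrable_mul (memLp_apply h₁ j))
    ((memLp_apply h₂ i).integrable_mul (memLp_apply h₂ j))

end Dcx

/-! ### Moments of the mixture. -/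

section LSE

variable {Ω : Type*} [MeasurableSpace Ω] {n q : ℕ} {Y : Ω → EuclideanSpace ℝ (Fin n)}
  {P : Measure Ω} {μ δ : EuclideanSpace ℝ (Fin n)} {S : Matrix (Fin n) (Fin n) ℝ} {g : ℝ → ℝ}
  {α β : EuclideanSpace ℝ (Fin q) → ℝ} {H : Measure (EuclideanSpace ℝ (Fin q))}
  [IsProbabilityMeasure H]

/-- First and second moments of a location-scale mixture of elliptical distributions. -/
lemma IsLSE.moments (hY : IsLSE Y P μ S δ g α β H) (hα : Measurable α) (hβ : Measurable β)
    (h2 : MemLp Y 2 P) :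
    MemLp (fun p : EuclideanSpace ℝ (Fin n) × EuclideanSpace ℝ (Fin q) => μ + β p.2 • δ) 2
        ((sphericalLaw n g).prod H) ∧
      MemLp (fun p : EuclideanSpace ℝ (Fin n) × EuclideanSpace ℝ (Fin q) => α p.2 • p.1) 2
        ((sphericalLaw n g).prod H) ∧
      (∀ i, ∫ ω, Y ω i ∂P = ∫ p, (μ + β p.2 • δ) i ∂((sphericalLaw n g).prod H)) ∧
      ∀ k i j, ∫ ω, Y ω i * Y ω j ∂P =
        (∫ p, (μ + β p.2 • δ) i * (μ + β p.2 • δ) j ∂((sphericalLaw n g).prod H)) +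
          secondMoment ((sphericalLaw n g).prod H) α k k * S i j := by
  have hν := hY.isProbabilityMeasure_sphericalLaw
  have hπ := isRotationInvariant_sphericalLaw_prod (n := n) H hY.measurable_generator
  obtain ⟨A, hA⟩ := hY.1.exists_mul_transpose
  have hdet := hY.1.isUnit_det_of_mul_transpose hA
  have hid := hY.identDistrib hα hβ hA
  have hb : Measurable fun z => μ + β z • δ := by fun_prop
  have hmem := hid.memLp_snd h2
  obtain ⟨hV, hU⟩ := hπ.memLp_of_memLp_add (b := fun z => μ + β z • δ) hdet hmem
  refine ⟨hV, hU, fun i => ?_, fun k i j => ?_⟩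
  · rw [← hπ.integral_apply (b := fun z => μ + β z • δ) hα hdet hmem i]
    exact (hid.comp (u := fun x : EuclideanSpace ℝ (Fin n) => x i) (by fun_prop)).integral_eq
  · rw [← hA, ← hπ.integral_apply_mul (b := fun z => μ + β z • δ) hb hα hdet hmem k i j]
    exact (hid.comp (u := fun x : EuclideanSpace ℝ (Fin n) => x i * x j)
      (by fun_prop)).integral_eq

end LSE

/-! ### Sufficiency and necessity for two mixtures. -/

section Comparison

variable {Ω₁ Ω₂ : Type*} [MeasurableSpace Ω₁] [MeasurableSpace Ω₂] {n q : ℕ}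
  {Y₁ : Ω₁ → EuclideanSpace ℝ (Fin n)} {P₁ : Measure Ω₁}
  {Y₂ : Ω₂ → EuclideanSpace ℝ (Fin n)} {P₂ : Measure Ω₂}
  {μ μ₁ μ₂ δ δ₁ δ₂ : EuclideanSpace ℝ (Fin n)} {S₁ S₂ : Matrix (Fin n) (Fin n) ℝ} {g : ℝ → ℝ}
  {α β : EuclideanSpace ℝ (Fin q) → ℝ} {H : Measure (EuclideanSpace ℝ (Fin q))}
  [IsProbabilityMeasure H]

lemma IsLSE.dcxLE (hα : Measurable α) (hβ : Measurable β)
    (hY₁ : IsLSE Y₁ P₁ μ S₁ δ g α β H) (hY₂ : IsLSE Y₂ P₂ μ S₂ δ g α β H)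
    (hle : ∀ i j, S₁ i j ≤ S₂ i j) : DcxLE Y₁ P₁ Y₂ P₂ := by
  intro f hfm hf h₁ h₂
  have hν := hY₁.isProbabilityMeasure_sphericalLaw
  obtain ⟨A₁, hA₁⟩ := hY₁.1.exists_mul_transpose
  obtain ⟨A₂, hA₂⟩ := hY₂.1.exists_mul_transpose
  have hb : Measurable fun z => μ + β z • δ := by fun_prop
  refine EReal.coe_sub_le_coe_sub ?_ h₁ h₂
  have key := (isRotationInvariant_sphericalLaw_prod (n := n) H
    hY₁.measurable_generator).lintegral_add_le hfm hb hα hf hY₁.1 hY₂.1 hle hA₁ hA₂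
  have e₁ := hY₁.identDistrib hα hβ hA₁
  have e₂ := hY₂.identDistrib hα hβ hA₂
  have m₁ : Measurable fun x => ENNReal.ofReal (f x) := by fun_prop
  have m₂ : Measurable fun x => ENNReal.ofReal (-f x) := by fun_prop
  have l₁ := (e₁.comp m₁).lintegral_eq
  have l₂ := (e₁.comp m₂).lintegral_eq
  have l₃ := (e₂.comp m₁).lintegral_eq
  have l₄ := (e₂.comp m₂).lintegral_eq
  simp only [Function.comp_apply] at l₁ l₂ l₃ l₄
  rw [l₁, l₂, l₃, l₄]
  exact key

/-- With common `μ` and `δ` the shift contributes equally to both mixed moments and cancels, leaving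
`m S₁ᵢⱼ ≤ m S₂ᵢⱼ` with `m > 0`. -/
lemma IsLSE.scale_le_of_dcxLE (hα : Measurable α) (hβ : Measurable β)
    (hY₁ : IsLSE Y₁ P₁ μ S₁ δ g α β H) (hY₂ : IsLSE Y₂ P₂ μ S₂ δ g α β H)
    (h₁ : MemLp Y₁ 2 P₁) (h₂ : MemLp Y₂ 2 P₂) (hα0 : ¬ ∀ᵐ z ∂H, α z = 0)
    (h : DcxLE Y₁ P₁ Y₂ P₂) (i j : Fin n) : S₁ i j ≤ S₂ i j := by
  have hν := hY₁.isProbabilityMeasure_sphericalLaw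
  obtain ⟨-, hU, -, m₁⟩ := hY₁.moments hα hβ h₁
  obtain ⟨-, -, -, m₂⟩ := hY₂.moments hα hβ h₂
  have hle := h.integral_apply_mul_le h₁ h₂ i j
  rw [m₁ i i j, m₂ i i j] at hle
  exact le_of_mul_le_mul_left (le_of_add_le_add_left hle)
    (secondMoment_pos hY₁.measurable_generator hα hU hα0 i)

lemma IsLSE.skewness_eq_of_dcxLE [IsFiniteMeasure P₁] [IsFiniteMeasure P₂]
    (hα : Measurable α) (hβ : Measurable β) (hβ_nonneg : ∀ z, 0 ≤ β z)
    (hY₁ : IsLSE Y₁ P₁ μ S₁ δ₁ g α β H) (hY₂ : IsLSE Y₂ P₂ μ S₂ δ₂ g α β H)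
    (h₁ : MemLp Y₁ 2 P₁) (h₂ : MemLp Y₂ 2 P₂) (hβ0 : ¬ ∀ᵐ z ∂H, β z = 0)
    (h : DcxLE Y₁ P₁ Y₂ P₂) : δ₁ = δ₂ := by
  have hν := hY₁.isProbabilityMeasure_sphericalLaw
  obtain ⟨hV₁, -, m₁, -⟩ := hY₁.moments hα hβ h₁
  obtain ⟨hV₂, -, m₂, -⟩ := hY₂.moments hα hβ h₂
  ext i
  have heq := h.integral_apply_eq h₁ h₂ i
  rw [m₁ i, m₂ i] at heq
  have hi : ∀ {δ : EuclideanSpace ℝ (Fin n)}, MemLp (fun p : EuclideanSpace ℝ (Fin n) ×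
      EuclideanSpace ℝ (Fin q) => μ + β p.2 • δ) 2 ((sphericalLaw n g).prod H) →
      Integrable (fun p : EuclideanSpace ℝ (Fin n) × EuclideanSpace ℝ (Fin q) => β p.2 * δ i)
        ((sphericalLaw n g).prod H) := fun {δ} hV => by
    have := ((memLp_apply hV i).integrable (by norm_num)).sub (integrable_const (μ i))
    refine this.congr (Filter.Eventually.of_forall fun p => ?_)
    simp
  have h0 : ¬ (fun p : EuclideanSpace ℝ (Fin n) × EuclideanSpace ℝ (Fin q) => β p.2)
      =ᵐ[(sphericalLaw n g).prod H] 0 := fun h0 => hβ0 <| by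
    obtain ⟨u, hu⟩ := (Measure.ae_ae_of_ae_prod h0).exists
    exact hu
  refine eq_of_integral_mul_eq
    (w := fun p : EuclideanSpace ℝ (Fin n) × EuclideanSpace ℝ (Fin q) => β p.2)
    (fun p => hβ_nonneg p.2) h0 (hi hV₁) (hi hV₂) ?_
  simp only [PiLp.add_apply, PiLp.smul_apply, smul_eq_mul] at heq
  rw [integral_add (integrable_const _) (hi hV₁), integral_add (integrable_const _) (hi hV₂)]
    at heq
  exact add_left_cancel heq

/-- The shifts are subtracted under the integral, where `β(z) δ` cancels pointwise, so no
integrability of `β` enters. -/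
lemma IsLSE.location_eq_of_dcxLE [IsFiniteMeasure P₁] [IsFiniteMeasure P₂]
    (hα : Measurable α) (hβ : Measurable β)
    (hY₁ : IsLSE Y₁ P₁ μ₁ S₁ δ g α β H) (hY₂ : IsLSE Y₂ P₂ μ₂ S₂ δ g α β H)
    (h₁ : MemLp Y₁ 2 P₁) (h₂ : MemLp Y₂ 2 P₂) (h : DcxLE Y₁ P₁ Y₂ P₂) : μ₁ = μ₂ := by
  have hν := hY₁.isProbabilityMeasure_sphericalLaw
  obtain ⟨hV₁, -, m₁, -⟩ := hY₁.moments hα hβ h₁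
  obtain ⟨hV₂, -, m₂, -⟩ := hY₂.moments hα hβ h₂
  ext i
  have heq := h.integral_apply_eq h₁ h₂ i
  rw [m₁ i, m₂ i, ← sub_eq_zero, ← integral_sub ((memLp_apply hV₁ i).integrable (by norm_num))
    ((memLp_apply hV₂ i).integrable (by norm_num))] at heq
  simpa [sub_eq_zero] using heq

end Comparison
theorem mainTheorem4 {n q : ℕ}
    {Ω₁ Ω₂ : Type*} [MeasurableSpace Ω₁] [MeasurableSpace Ω₂]
    (P₁ : Measure Ω₁) [IsProbabilityMeasure P₁] (P₂ : Measure Ω₂) [IsProbabilityMeasure P₂]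
    (Y₁ : Ω₁ → EuclideanSpace ℝ (Fin n)) (Y₂ : Ω₂ → EuclideanSpace ℝ (Fin n))
    (μ₁ μ₂ δ₁ δ₂ : EuclideanSpace ℝ (Fin n)) (S₁ S₂ : Matrix (Fin n) (Fin n) ℝ)
    (g : ℝ → ℝ)
    (α β : EuclideanSpace ℝ (Fin q) → ℝ)
    (hα_meas : Measurable α) (hβ_meas : Measurable β)
    (hα_nonneg : ∀ z, 0 ≤ α z) (hβ_nonneg : ∀ z, 0 ≤ β z)
    (H : Measure (EuclideanSpace ℝ (Fin q))) [IsProbabilityMeasure H]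
    (hY₁ : IsLSE Y₁ P₁ μ₁ S₁ δ₁ g α β H)
    (hY₂ : IsLSE Y₂ P₂ μ₂ S₂ δ₂ g α β H) :
    (μ₁ = μ₂ → δ₁ = δ₂ → (∀ i j, S₁ i j ≤ S₂ i j) → DcxLE Y₁ P₁ Y₂ P₂) ∧
    (MemLp Y₁ 2 P₁ → MemLp Y₂ 2 P₂ → ¬ (∀ᵐ z ∂H, α z = 0) → ¬ (∀ᵐ z ∂H, β z = 0) →
      μ₁ = μ₂ → (DcxLE Y₁ P₁ Y₂ P₂ ↔ δ₁ = δ₂ ∧ ∀ i j, S₁ i j ≤ S₂ i j)) ∧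
    (MemLp Y₁ 2 P₁ → MemLp Y₂ 2 P₂ → ¬ (∀ᵐ z ∂H, α z = 0) →
      δ₁ = δ₂ → (DcxLE Y₁ P₁ Y₂ P₂ ↔ μ₁ = μ₂ ∧ ∀ i j, S₁ i j ≤ S₂ i j)) := by
  refine ⟨?_, ?_, ?_⟩
  · rintro rfl rfl hle
    exact hY₁.dcxLE hα_meas hβ_meas hY₂ hle
  · rintro h₁ h₂ hα0 hβ0 rfl
    refine ⟨fun h => ?_, ?_⟩
    · obtain rfl := hY₁.skewness_eq_of_dcxLE hα_meas hβ_meas hβ_nonneg hY₂ h₁ h₂ hβ0 h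
      exact ⟨rfl, hY₁.scale_le_of_dcxLE hα_meas hβ_meas hY₂ h₁ h₂ hα0 h⟩
    · rintro ⟨rfl, hle⟩
      exact hY₁.dcxLE hα_meas hβ_meas hY₂ hle
  · rintro h₁ h₂ hα0 rfl
    refine ⟨fun h => ?_, ?_⟩
    · obtain rfl := hY₁.location_eq_of_dcxLE hα_meas hβ_meas hY₂ h₁ h₂ h
      exact ⟨rfl, hY₁.scale_le_of_dcxLE hα_meas hβ_meas hY₂ h₁ h₂ hα0 h⟩
    · rintro ⟨rfl, hle⟩
      exact hY₁.dcxLE hα_meas hβ_meas hY₂ hle
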